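/- Let $\Omega$ be a set and let $\Psi$ be a non-empty set of test functions on $\Omega$: a set of functions $\psi:\Omega\to\mathbb C$ such that $\sup_{\psi\in\Psi}|\psi(x)|<1$ for each $x\in\Omega$ and, for each finite $F\subset\Omega$, the restrictions $\psi|_F$ $(\psi\in\Psi)$ together with the constants generate the algebra of all functions $F\to\mathbb C$. Give $\Psi$ the topology of pointwise convergence on $\Omega$, let $\mathcal C_b(\Psi)$ be the $C^*$-algebra of bounded continuous functions on $\Psi$, and let $E(x)\in\mathcal C_b(\Psi)$ be $E(x)(\psi)=\psi(x)$. Let $\mathscr U,\mathscr Y$ be complex Hilbert spaces. A function $k:\Omega\times\Omega\to B(\mathcal E)$ ($\mathcal E$ a Hilbert space) is a positive kernel if $\sum_{i,j=1}^n\langle k(z_i,z_j)e_j,e_i\rangle\ge0$ for all $n$, $z_i\in\Omega$, $e_i\in\mathcal E$; it is $\Psi$-admissible if moreover, for each $\psi\in\Psi$, $h\mapsto\psi h$ is a contraction of the reproducing kernel Hilbert space $\mathcal H(k)$ into itself. A function $S:\Omega\to B(\mathscr U,\mathscr Y)$ is in $H^\infty_\Psi(\mathscr U,\mathscr Y)$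 if there is $C\ge0$ such that $(x,y)\mapsto(C^2I_{\mathscr Y}-S(x)S(y)^*)\otimes k(x,y)$ is a positive $B(\mathscr Y\otimes\mathscr Y)$-valued kernel for every $\Psi$-admissible $k:\Omega\times\Omega\to B(\mathscr Y)$; $C_S$ is the smallest such $C$, and the $\Psi$-Schur–Agler class $\mathcal{SA}_\Psi(\mathscr U,\mathscr Y)$ is the set of those $S\in H^\infty_\Psi(\mathscr U,\mathscr Y)$ with $C_S\le1$. For a set $Z$ and $C^*$-algebras $\mathscr A,\mathscr B$, a function $\Gamma:Z\times Z\to B(\mathscr A,\mathscr B)$ is a completely positive kernel if $\sum_{i,j=1}^n b_i^*\,\Gamma(z_i,z_j)(a_i^*a_j)\,b_j\ge0$ for all $n$, $a_i\in\mathscr A$, $b_i\in\mathscr B$, $z_i\in Z$. A $*$-representation of $\mathcal C_b(\Psi)$ on a Hilbert space $\mathscr X$ is a $*$-homomorphism $\rho:\mathcal C_b(\Psi)\to B(\mathscr X)$, not required to be unital. **Theorem.** Let $\Omega_0\subset\Omega$ and $S_0:\Omega_0\to B(\mathscr U,\mathscr Y)$. The following are equivalent. 1. There is $S\in\mathcal{SA}_\Psi(\mathscr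 U,\mathscr Y)$ with $S|_{\Omega_0}=S_0$. 2. There is a completely positive kernel $\Gamma:\Omega_0\times\Omega_0\to B(\mathcal C_b(\Psi),B(\mathscr Y))$ such that $I_{\mathscr Y}-S_0(z)S_0(w)^*=\Gamma(z,w)\big(1-E(z)E(w)^*\big)$ for all $z,w\in\Omega_0$. 3. There are a Hilbert space $\mathscr X$, a $*$-representation $\rho:\mathcal C_b(\Psi)\to B(\mathscr X)$ and a unitary operator $V=\begin{pmatrix}A&B\\C&D\end{pmatrix}:\mathscr X\oplus\mathscr U\to\mathscr X\oplus\mathscr Y$ such that $S_0(z)=D+C\,(I_{\mathscr X}-\rho(E(z))A)^{-1}\rho(E(z))B$ for all $z\in\Omega_0$. 4. There are a Hilbert space $\mathscr X$, a $*$-representation $\rho:\mathcal C_b(\Psi)\to B(\mathscr X)$ and a unitary operator $W=\begin{pmatrix}A_1&B_1\\C_1&D_1\end{pmatrix}:\mathscr X\oplus\mathscr Y\to\mathscr X\oplus\mathscr U$ such that $S_0(z)^*=D_1+C_1\,(I_{\mathscr X}-\rho(E(z))^*A_1)^{-1}\rho(E(z))^*B_1$ for all $z\in\Omega_0$. Moreover,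 each of (3) and (4) with $\rho$ required to be unital is also equivalent to these conditions. -/

import Mathlib

open scoped BoundedContinuousFunction ComplexOrder TensorProduct

universe u v w

namespace SchurAgler

noncomputable section

/-! ### Test functions -/

/-- `Ψ` is a set of test functions on `Ω`: `sup {|ψ x| : ψ ∈ Ψ} < 1` at every point `x`, and for
every finite `F ⊆ Ω` the restrictions to `F`, together with the constants, generate the algebra of
all functions on `F`. -/
structure IsTestFunctions {Ω : Type u} (Ψ : Set (Ω → ℂ)) : Prop where
  sup_lt_one : ∀ x : Ω, ∃ r : ℝ, r < 1 ∧ ∀ ψ ∈ Ψ, ‖ψ x‖ ≤ r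
  generates : ∀ F : Finset Ω,
    Algebra.adjoin ℂ ((fun (ψ : Ω → ℂ) (x : F) => ψ x) '' Ψ) = ⊤

/-- The C⋆-algebra `C_b(Ψ)` of bounded continuous functions on `Ψ`, where `Ψ ⊆ ℂ^Ω` carries the
topology of pointwise convergence (the subspace topology of the product topology). -/
abbrev Cb {Ω : Type u} (Ψ : Set (Ω → ℂ)) : Type u := Ψ →ᵇ ℂ

/-- The evaluation `E(x) ∈ C_b(Ψ)`, `E(x)(ψ) = ψ(x)`. -/
def evalE {Ω : Type u} {Ψ : Set (Ω → ℂ)} (hΨ : IsTestFunctions Ψ) (x : Ω) : Cb Ψ :=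
  BoundedContinuousFunction.ofNormedAddCommGroup (fun ψ : Ψ => ψ.1 x)
    ((continuous_apply x).comp continuous_subtype_val) 1 (fun ψ => by
      obtain ⟨r, hr, h⟩ := hΨ.sup_lt_one x
      exact (h ψ.1 ψ.2).trans hr.le)

/-! ### Positive kernels and admissible kernels -/

/-- A positive `B(E)`-valued kernel: `∑ᵢⱼ ⟨k(zᵢ, zⱼ) eⱼ, eᵢ⟩ ≥ 0`. (Mathlib's inner product is
conjugate-linear in its first argument; `0 ≤ c` for complex `c` means that `c` is real and
nonnegative.) -/
def IsPositiveKernel {Ω : Type*} {E : Type*} [NormedAddCommGroup E] [InnerProductSpace ℂ E]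
    (k : Ω → Ω → (E →L[ℂ] E)) : Prop :=
  ∀ (n : ℕ) (z : Fin n → Ω) (e : Fin n → E),
    0 ≤ ∑ i, ∑ j, inner ℂ (e i) (k (z i) (z j) (e j))

theorem IsPositiveKernel.isHermitian {Ω : Type*} {E : Type*} [NormedAddCommGroup E]
    [InnerProductSpace ℂ E] [CompleteSpace E] {k : Ω → Ω → (E →L[ℂ] E)}
    (hk : IsPositiveKernel k) : (Matrix.of k).IsHermitian := by
  have key : ∀ (x y : Ω) (a b : E),
      (inner ℂ a (k x y b) + inner ℂ b (k y x a)).im = 0 := by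
    intro x y a b
    have h2 := (Complex.le_def.1 (hk 2 ![x, y] ![a, b])).2
    have hx := (Complex.le_def.1 (hk 1 ![x] ![a])).2
    have hy := (Complex.le_def.1 (hk 1 ![y] ![b])).2
    simp [Fin.sum_univ_two] at h2 hx hy
    simp
    linarith
  refine Matrix.ext fun x y =>
    ContinuousLinearMap.ext fun b => ext_inner_left ℂ fun a => ?_
  rw [Matrix.conjTranspose_apply, ContinuousLinearMap.star_eq_adjoint,
    ContinuousLinearMap.adjoint_inner_right, Matrix.of_apply, Matrix.of_apply]
  have h1 := key x y a b
  have h2 := key x y (Complex.I • a) b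
  simp at h1 h2
  rw [← inner_conj_symm (k y x a) b]
  apply Complex.ext
  · rw [Complex.conj_re]; linarith
  · rw [Complex.conj_im]; linarith

theorem IsPositiveKernel.posSemidef {Ω : Type*} {E : Type*} [NormedAddCommGroup E]
    [InnerProductSpace ℂ E] [CompleteSpace E] {k : Ω → Ω → (E →L[ℂ] E)}
    (hk : IsPositiveKernel k) : (Matrix.of k).PosSemidef := by
  have htfae := (RKHS.posSemidef_tfae (𝕜 := ℂ) (K := Matrix.of k)).out 0 2
  refine htfae.2 ⟨hk.isHermitian, fun f => ?_⟩
  have e := f.support.equivFin.symm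
  have h := (Complex.le_def.1 (hk f.support.card (fun i => e i) (fun i => f (e i)))).1
  have h3 : ∑ i, ∑ j, inner ℂ (f (e i)) (k (e i) (e j) (f (e j)))
      = ∑ x ∈ f.support, ∑ y ∈ f.support, inner ℂ (f x) (k x y (f y)) := by
    rw [← Finset.sum_coe_sort f.support, ← Equiv.sum_comp e]
    refine Finset.sum_congr rfl fun i _ => ?_
    rw [← Finset.sum_coe_sort f.support, ← Equiv.sum_comp e]
  rw [h3, Finset.sum_comm] at h
  have h4 : (f.sum fun x w => f.sum fun x' w' => inner ℂ (Matrix.of k x' x w) w')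
      = (starRingEnd ℂ)
        (∑ y ∈ f.support, ∑ x ∈ f.support, inner ℂ (f x) (k x y (f y))) := by
    simp [Finsupp.sum, map_sum]
  rw [h4, RCLike.conj_re]
  exact h

/-- The Hilbert space `H(K)` of `E`-valued functions on `Ω` with reproducing kernel `K`. -/
abbrev HilbertOfKernel {Ω : Type*} {E : Type*} [NormedAddCommGroup E]
    [InnerProductSpace ℂ E] [CompleteSpace E] (K : Ω → Ω → (E →L[ℂ] E))
    [Fact (Matrix.of K).PosSemidef] : Type _ :=
  RKHS.OfKernel (Matrix.of K)

/-- `K` is `Ψ`-admissible: it is a positive kernel, and for each `ψ ∈ Ψ` multiplication by `ψ`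
maps `H(K)` into itself and is a contraction there. -/
def IsAdmissible {Ω : Type u} (Ψ : Set (Ω → ℂ)) {E : Type*} [NormedAddCommGroup E]
    [InnerProductSpace ℂ E] [CompleteSpace E] (K : Ω → Ω → (E →L[ℂ] E)) : Prop :=
  ∃ hK : IsPositiveKernel K,
    haveI : Fact (Matrix.of K).PosSemidef := ⟨hK.posSemidef⟩
    ∀ ψ ∈ Ψ, ∀ h : HilbertOfKernel K, ∃ g : HilbertOfKernel K,
      (∀ x, g x = ψ x • h x) ∧ ‖g‖ ≤ ‖h‖

/-! ### The Schur–Agler class -/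

/-- The Hilbert space tensor product: the completion of the algebraic tensor product with respect
to the inner product `⟨a ⊗ b, c ⊗ d⟩ = ⟨a, c⟩ ⟨b, d⟩`. -/
abbrev HilbertTensor (E F : Type*) [NormedAddCommGroup E] [InnerProductSpace ℂ E]
    [NormedAddCommGroup F] [InnerProductSpace ℂ F] : Type _ :=
  UniformSpace.Completion (E ⊗[ℂ] F)

/-- The operator `A ⊗ B` on the Hilbert space tensor product. -/
def tensorOp {E F : Type*} [NormedAddCommGroup E] [InnerProductSpace ℂ E]
    [NormedAddCommGroup F] [InnerProductSpace ℂ F] (A : E →L[ℂ] E) (B : F →L[ℂ] F) :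
    HilbertTensor E F →L[ℂ] HilbertTensor E F :=
  (TensorProduct.mapL A B).completion

section SchurAglerClass

variable {Ω : Type u} (Ψ : Set (Ω → ℂ))
  {U : Type v} [NormedAddCommGroup U] [InnerProductSpace ℂ U] [CompleteSpace U]
  {Y : Type w} [NormedAddCommGroup Y] [InnerProductSpace ℂ Y] [CompleteSpace Y]

/-- `C ≥ 0` and `(C² I - S(x) S(y)*) ⊗ k(x, y)` is a positive `B(Y ⊗ Y)`-valued kernel for every
`B(Y)`-valued `Ψ`-admissible kernel `k`. -/
def IsBound (S : Ω → (U →L[ℂ] Y)) (C : ℝ) : Prop :=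
  0 ≤ C ∧ ∀ k : Ω → Ω → (Y →L[ℂ] Y), IsAdmissible Ψ k →
    IsPositiveKernel fun x y =>
      tensorOp (((C : ℂ) ^ 2) • (1 : Y →L[ℂ] Y) - (S x) ∘L (S y).adjoint) (k x y)

/-- The space `H^∞_Ψ(U, Y)`. -/
def HInfty : Set (Ω → (U →L[ℂ] Y)) := {S | ∃ C : ℝ, IsBound Ψ S C}

/-- The smallest constant `C_S` (meaningful for `S ∈ H^∞_Ψ(U, Y)`). -/
def smallestBound (S : Ω → (U →L[ℂ] Y)) : ℝ := sInf {C : ℝ | IsBound Ψ S C}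

/-- The `Ψ`-Schur–Agler class. -/
def schurAglerClass : Set (Ω → (U →L[ℂ] Y)) := {S | S ∈ HInfty Ψ ∧ smallestBound Ψ S ≤ 1}

end SchurAglerClass

/-! ### Completely positive kernels -/

/-- A completely positive kernel `Γ : Z × Z → B(A, B)`, for C⋆-algebras `A` and `B`:
`∑ᵢⱼ bᵢ* Γ(zᵢ, zⱼ)(aᵢ* aⱼ) bⱼ ≥ 0`. -/
def IsCompletelyPositiveKernel {Z : Type*} {A B : Type*} [CStarAlgebra A] [CStarAlgebra B]
    [PartialOrder B] [StarOrderedRing B] (Γ : Z → Z → (A →L[ℂ] B)) : Prop :=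
  ∀ (n : ℕ) (a : Fin n → A) (b : Fin n → B) (z : Fin n → Z),
    0 ≤ ∑ i, ∑ j, star (b i) * Γ (z i) (z j) (star (a i) * a j) * b j

/-! ### Unitary colligations -/

/-- A `Ψ`-unitary colligation `(V, ρ)` with state space `X`: a unitary operator
`V : X ⊕ U → X ⊕ Y` (Hilbert space direct sums) and a `*`-representation `ρ` of `C_b(Ψ)` on `X`. -/
structure UnitaryColligation {Ω : Type u} (Ψ : Set (Ω → ℂ))
    (X : Type*) [NormedAddCommGroup X] [InnerProductSpace ℂ X] [CompleteSpace X]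
    (U : Type*) [NormedAddCommGroup U] [InnerProductSpace ℂ U]
    (Y : Type*) [NormedAddCommGroup Y] [InnerProductSpace ℂ Y] where
  V : WithLp 2 (X × U) ≃ₗᵢ[ℂ] WithLp 2 (X × Y)
  ρ : Cb Ψ →⋆ₙₐ[ℂ] (X →L[ℂ] X)

namespace UnitaryColligation

variable {Ω : Type u} {Ψ : Set (Ω → ℂ)}
  {X : Type*} [NormedAddCommGroup X] [InnerProductSpace ℂ X] [CompleteSpace X]
  {U : Type*} [NormedAddCommGroup U] [InnerProductSpace ℂ U]
  {Y : Type*} [NormedAddCommGroup Y] [InnerProductSpace ℂ Y]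
  (c : UnitaryColligation Ψ X U Y)

/-- `V` as a bounded operator between the underlying products. -/
def op : X × U →L[ℂ] X × Y :=
  (WithLp.prodContinuousLinearEquiv 2 ℂ X Y : WithLp 2 (X × Y) →L[ℂ] X × Y) ∘L
    (c.V.toContinuousLinearEquiv : WithLp 2 (X × U) →L[ℂ] WithLp 2 (X × Y)) ∘L
    ((WithLp.prodContinuousLinearEquiv 2 ℂ X U).symm : X × U →L[ℂ] WithLp 2 (X × U))

/-- The block `A : X → X` of `V`. -/
def A : X →L[ℂ] X := .fst ℂ X Y ∘L c.op ∘L .inl ℂ X U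

/-- The block `B : U → X` of `V`. -/
def B : U →L[ℂ] X := .fst ℂ X Y ∘L c.op ∘L .inr ℂ X U

/-- The block `C : X → Y` of `V`. -/
def C : X →L[ℂ] Y := .snd ℂ X Y ∘L c.op ∘L .inl ℂ X U

/-- The block `D : U → Y` of `V`. -/
def D : U →L[ℂ] Y := .snd ℂ X Y ∘L c.op ∘L .inr ℂ X U

/-- `D + C (I - T A)⁻¹ T B` for an operator `T` on the state space. The inverse is a genuine one
whenever `‖T‖ < 1`, since `A` is a contraction. -/
def transfer (T : X →L[ℂ] X) : U →L[ℂ] Y :=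
  c.D + c.C ∘L Ring.inverse (1 - T * c.A) ∘L T ∘L c.B

end UnitaryColligation

/-! ### The conditions -/

section Conditions

variable {Ω : Type u} {Ψ : Set (Ω → ℂ)} (hΨ : IsTestFunctions Ψ)
  {U : Type v} [NormedAddCommGroup U] [InnerProductSpace ℂ U] [CompleteSpace U]
  {Y : Type w} [NormedAddCommGroup Y] [InnerProductSpace ℂ Y] [CompleteSpace Y]
  {Ω₀ : Set Ω} (S₀ : Ω₀ → (U →L[ℂ] Y))

/-- `S₀` has an Agler decomposition on `Ω₀`. -/
def HasAglerDecomposition : Prop :=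
  ∃ Γ : Ω₀ → Ω₀ → (Cb Ψ →L[ℂ] (Y →L[ℂ] Y)), IsCompletelyPositiveKernel Γ ∧
    ∀ z w : Ω₀, 1 - (S₀ z) ∘L (S₀ w).adjoint = Γ z w (1 - evalE hΨ z * star (evalE hΨ w))

end Conditions

end

end SchurAgler

open SchurAgler

/-! Passing to adjoints, an Agler decomposition says that ⟨y, y'⟩ - ⟨S(z)* y, S(w)* y'⟩ is the value
at 1 - E(z)E(w)* of a positive family of functionals on `Cb Ψ`. The GNS construction turns such a
family into vectors xᵢ and a representation ρ, and the identity then says that the pairs (ρ(E(pᵢ))*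
xᵢ, yᵢ) and (xᵢ, S(pᵢ)* yᵢ) have equal Gram matrices. The resulting isometry becomes unitary on a
larger state space, and solving the linear system it encodes gives the transfer formula
(`exists_unitary_dilation`, `exists_colligation`). Conversely, unitarity of a colligation is an
energy balance (`inner_state`) from which a decomposition is read off when ρ is unital.

Membership in the Schur–Agler class yields a decomposition by duality. The kernels with a
decomposition form a convex cone, which is closed because |E(x)| stays away from 1 and hence the
defect controls the functionals. Otherwise a functional separates the kernel from the cone. It
involves finitely many coordinates, and since evaluations at each ψ give elements of the cone, its
coefficients are the entries of an admissible kernel of finite rank (`mem_aglerCone_of_forall`,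
`isAdmissible_finiteKernel`). Testing the Schur–Agler inequality against that kernel contradicts the
separation.

A realization lands in the class because a positive family pairs nonnegatively with every pointwise
positive matrix of functions (`sum_apply_nonneg`), and admissibility of k makes k(x, y)(1 -
E(x)E(y)*) such a matrix. If ρ is not unital, the projection 1 - ρ(1) only adds a positive term. The
transfer formula makes sense on all of Ω, which provides the extension. -/

namespace SchurAgler

noncomputable section

/-! ### Positivity of finite double sums -/

/-- `G` is nonnegative on all finite families. -/
def SumNonneg {T : Type*} (G : T → T → ℂ) : Prop :=
  ∀ (n : ℕ) (t : Fin n → T), 0 ≤ ∑ i, ∑ j, G (t i) (t j)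

theorem SumNonneg.fintype {T : Type*} {G : T → T → ℂ} (hG : SumNonneg G) {J : Type*} [Fintype J]
    (t : J → T) : 0 ≤ ∑ i, ∑ j, G (t i) (t j) := by
  have e := (Fintype.equivFin J).symm
  have h := hG _ (fun i => t (e i))
  rw [← Equiv.sum_comp e]
  simp_rw [← Equiv.sum_comp e (fun j => G (t (e _)) (t j))]
  exact h

theorem SumNonneg.finset {T : Type*} {G : T → T → ℂ} (hG : SumNonneg G) {J : Type*} (s : Finset J)
    (t : J → T) : 0 ≤ ∑ i ∈ s, ∑ j ∈ s, G (t i) (t j) := by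
  have h := hG.fintype (fun i : s => t i)
  rw [← Finset.sum_coe_sort s]
  simp_rw [← Finset.sum_coe_sort s (fun j => G (t _) (t j))]
  exact h

/-- A sesquilinear-type kernel with nonnegative double sums is Hermitian. -/
theorem SumNonneg.conj_symm {T : Type*} {G : T → T → ℂ} (hG : SumNonneg G) (r : T → T)
    (h1 : ∀ s t, G (r s) t = -Complex.I * G s t) (h2 : ∀ s t, G s (r t) = Complex.I * G s t)
    (s t : T) : starRingEnd ℂ (G s t) = G t s := by
  have key : ∀ s t, (G s t + G t s).im = 0 := by
    intro s t
    have h2 := (Complex.le_def.1 (hG 2 ![s, t])).2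
    have hx := (Complex.le_def.1 (hG 1 ![s])).2
    have hy := (Complex.le_def.1 (hG 1 ![t])).2
    simp [Fin.sum_univ_two] at h2 hx hy
    simp
    linarith
  have k1 := key s t
  -- `r` plays multiplication by i, so the same identity at `r s` controls the real parts.
  have k2 := key (r s) t
  rw [h1, h2] at k2
  simp at k1 k2
  apply Complex.ext
  · rw [Complex.conj_re]; linarith
  · rw [Complex.conj_im]; linarith

/-! ### Square roots of bounded continuous functions -/

/-- A self-adjoint f is positive iff ‖t - f‖ ≤ t for a given t ≥ ‖f‖. The norm is a supremum over
points, so with t = ‖f‖ this can be checked pointwise. -/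
theorem exists_eq_star_mul_self {X : Type*} [TopologicalSpace X] {M : Type*} [CStarAlgebra M]
    [PartialOrder M] [StarOrderedRing M] (f : X →ᵇ M) (hf : ∀ x, 0 ≤ f x) :
    ∃ s : X →ᵇ M, f = star s * s := by
  let _ := CStarAlgebra.spectralOrder (X →ᵇ M)
  have _ := CStarAlgebra.spectralOrderedRing (X →ᵇ M)
  have hsa : IsSelfAdjoint f := by
    ext x
    exact (hf x).isSelfAdjoint
  rw [← CStarAlgebra.nonneg_iff_eq_star_mul_self,
    nonneg_iff_isSelfAdjoint_and_quasispectrumRestricts]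
  refine ⟨hsa, ?_⟩
  rw [← SpectrumRestricts, SpectrumRestricts.nnreal_iff_nnnorm hsa le_rfl, ← NNReal.coe_le_coe,
    coe_nnnorm, BoundedContinuousFunction.norm_le (by positivity)]
  intro x
  have hx : ‖f x‖₊ ≤ ‖f‖₊ := f.norm_coe_le_norm x
  have h := ((nonneg_iff_isSelfAdjoint_and_quasispectrumRestricts.1 (hf x)).2)
  rw [← SpectrumRestricts, SpectrumRestricts.nnreal_iff_nnnorm (hf x).isSelfAdjoint hx,
    ← NNReal.coe_le_coe] at h
  exact h

/-- Pairing a positive family of functionals with a pointwise positive matrix of functions. -/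
theorem sum_apply_nonneg {X : Type*} [TopologicalSpace X] {n : ℕ}
    (φ : Fin n → Fin n → (X →ᵇ ℂ) →ₗ[ℂ] ℂ)
    (hφ : ∀ a : Fin n → (X →ᵇ ℂ), 0 ≤ ∑ k, ∑ l, φ k l (star (a k) * a l))
    (m : Fin n → Fin n → (X →ᵇ ℂ))
    (hm : ∀ (x : X) (v : Fin n → ℂ), 0 ≤ ∑ k, ∑ l, starRingEnd ℂ (v k) * m k l x * v l) :
    0 ≤ ∑ k, ∑ l, φ k l (m k l) := by
  obtain ⟨e, heL⟩ : ∃ e : Fin n → EuclideanSpace ℂ (Fin n), ∀ k v, inner ℂ (e k) v = v k :=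
    ⟨fun k => EuclideanSpace.single k 1, fun k v => by simp [EuclideanSpace.inner_single_left]⟩
  have heR : ∀ k v, inner ℂ v (e k) = starRingEnd ℂ (v k) := fun k v => by
    rw [← inner_conj_symm, heL]
  have hee : ∀ k l, (e k) l = if l = k then 1 else 0 := fun k l => by
    have h : e k = EuclideanSpace.single k 1 := ext_inner_right ℂ fun v => by
      rw [heL, EuclideanSpace.inner_single_left]; simp
    simp [h]
  let inj : Fin n → Fin n → (X →ᵇ ℂ) →L[ℂ]
      (X →ᵇ (EuclideanSpace ℂ (Fin n) →L[ℂ] EuclideanSpace ℂ (Fin n))) := fun k l =>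
    (ContinuousLinearMap.toSpanSingleton ℂ
      (InnerProductSpace.rankOne ℂ (e k) (e l))).compLeftContinuousBounded X
  let ent : Fin n → Fin n →
      (EuclideanSpace ℂ (Fin n) →L[ℂ] EuclideanSpace ℂ (Fin n)) →L[ℂ] ℂ := fun k l =>
    (innerSL ℂ (e k)) ∘L (ContinuousLinearMap.apply ℂ (EuclideanSpace ℂ (Fin n)) (e l))
  -- The matrix `m` becomes one positive element of a C⋆-algebra. A factorization F = s* s, read in
  -- entries `σ` of `s`, writes `m` as a sum of matrices (σᵢₖ* σᵢₗ), on each of which `hφ` applies.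
  let F : X →ᵇ (EuclideanSpace ℂ (Fin n) →L[ℂ] EuclideanSpace ℂ (Fin n)) :=
    ∑ k, ∑ l, inj k l (m k l)
  have hFx : ∀ x v, F x v = ∑ k, ∑ l, (m k l x * v l) • e k := by
    intro x v
    simp [F, inj, heL, BoundedContinuousFunction.sum_apply, mul_smul]
  have hin : ∀ x v, inner ℂ v (F x v) = ∑ k, ∑ l, starRingEnd ℂ (v k) * m k l x * v l := by
    intro x v
    rw [hFx]
    simp only [inner_sum, inner_smul_right, heR]
    refine Finset.sum_congr rfl fun k _ => Finset.sum_congr rfl fun l _ => by ring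
  have hF : ∀ x, 0 ≤ F x := by
    intro x
    rw [ContinuousLinearMap.nonneg_iff_isPositive, ContinuousLinearMap.isPositive_iff_complex]
    intro v
    have h := hm x v
    rw [← hin] at h
    have h' : inner ℂ (F x v) v = inner ℂ v (F x v) := by
      rw [← inner_conj_symm]
      exact h.isSelfAdjoint
    rw [h']
    obtain ⟨h3, h4⟩ := Complex.le_def.1 h
    exact ⟨Complex.ext (by simp) (by simpa using h4), h3⟩
  obtain ⟨s, hs⟩ := exists_eq_star_mul_self F hF
  let σ : Fin n → Fin n → (X →ᵇ ℂ) := fun i l => (ent i l).compLeftContinuousBounded X s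
  have hms : ∀ k l, m k l = ∑ i, star (σ i k) * σ i l := by
    intro k l
    ext x
    have h1 : m k l x = inner ℂ (e k) (F x (e l)) := by
      rw [hFx]
      simp [heL, hee]
    rw [h1, hs]
    simp only [BoundedContinuousFunction.sum_apply, BoundedContinuousFunction.mul_apply,
      BoundedContinuousFunction.star_apply]
    rw [ContinuousLinearMap.star_eq_adjoint, mul_apply_eq_comp,
      ContinuousLinearMap.adjoint_inner_right]
    rw [PiLp.inner_apply]
    simp [σ, ent, heL, mul_comm]
  have : ∑ k, ∑ l, φ k l (m k l) = ∑ i, ∑ k, ∑ l, φ k l (star (σ i k) * σ i l) := by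
    simp_rw [hms, map_sum]
    rw [Finset.sum_comm]
    conv_rhs => rw [Finset.sum_comm]
    rw [Finset.sum_comm]
    refine Finset.sum_congr rfl fun k _ => ?_
    rw [Finset.sum_comm]
  rw [this]
  exact Finset.sum_nonneg fun i _ => hφ _

/-! ### Unitary dilations -/

theorem denseRange_linearCombination {J H : Type*} [NormedAddCommGroup H] [InnerProductSpace ℂ H]
    [CompleteSpace H] {f : J → H} (hf : (Submodule.span ℂ (Set.range f))ᗮ = ⊥) :
    DenseRange (Finsupp.linearCombination ℂ f) := by
  rw [← Submodule.topologicalClosure_eq_top_iff, ← Finsupp.range_linearCombination] at hf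
  exact Submodule.dense_iff_topologicalClosure_eq_top.2 hf

theorem inner_linearCombination {J H : Type*} [NormedAddCommGroup H] [InnerProductSpace ℂ H]
    (f : J → H) (x y : J →₀ ℂ) :
    inner ℂ (Finsupp.linearCombination ℂ f x) (Finsupp.linearCombination ℂ f y) =
      x.sum fun i a => y.sum fun j b => starRingEnd ℂ a * b * inner ℂ (f i) (f j) := by
  simp only [Finsupp.linearCombination_apply, Finsupp.sum, sum_inner, inner_smul_left]
  simp only [inner_sum, inner_smul_right, Finset.mul_sum]
  refine Finset.sum_congr rfl fun k _ => Finset.sum_congr rfl fun l _ => by ring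

/-- Two total families with the same Gram matrix are unitarily equivalent. -/
theorem exists_unitary_of_gram {J H₁ H₂ : Type*} [NormedAddCommGroup H₁] [InnerProductSpace ℂ H₁]
    [CompleteSpace H₁] [NormedAddCommGroup H₂] [InnerProductSpace ℂ H₂] [CompleteSpace H₂]
    (f : J → H₁) (g : J → H₂) (hfg : ∀ i j, inner ℂ (f i) (f j) = inner ℂ (g i) (g j))
    (hf : (Submodule.span ℂ (Set.range f))ᗮ = ⊥) (hg : (Submodule.span ℂ (Set.range g))ᗮ = ⊥) :
    ∃ W : H₁ ≃ₗᵢ[ℂ] H₂, ∀ j, W (f j) = g j := by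
  have hn : ∀ x, ‖Finsupp.linearCombination ℂ g x‖ = ‖Finsupp.linearCombination ℂ f x‖ := by
    intro x
    rw [@norm_eq_sqrt_re_inner ℂ, @norm_eq_sqrt_re_inner ℂ, inner_linearCombination,
      inner_linearCombination]
    simp only [hfg]
  refine ⟨(LinearEquiv.refl ℂ (J →₀ ℂ)).extendOfIsometry (Finsupp.linearCombination ℂ f)
    (Finsupp.linearCombination ℂ g) (denseRange_linearCombination hf)
    (denseRange_linearCombination hg) hn, fun j => ?_⟩
  have := (LinearEquiv.refl ℂ (J →₀ ℂ)).extendOfIsometry_eq (Finsupp.linearCombination ℂ f)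
    (Finsupp.linearCombination ℂ g) (denseRange_linearCombination hf)
    (denseRange_linearCombination hg) hn (Finsupp.single j 1)
  simpa using this

/-- The family `f` in `X ⊕ Y` together with a family `b` in `X ⊕ Y` and the standard basis
of `ℓ²(κ)`, in `(X ⊕ ℓ²(κ)) ⊕ Y`. -/
def dilationFamily {J ι κ X Y : Type*} [DecidableEq κ]
    [NormedAddCommGroup X] [NormedAddCommGroup Y] (f : J → X × Y) (b : ι → X × Y) :
    J ⊕ (ι ⊕ κ) → WithLp 2 (WithLp 2 (X × lp (fun _ : κ => ℂ) 2) × Y)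
  | .inl j => WithLp.toLp 2 (WithLp.toLp 2 ((f j).1, 0), (f j).2)
  | .inr (.inl i) => WithLp.toLp 2 (WithLp.toLp 2 ((b i).1, 0), (b i).2)
  | .inr (.inr k) => WithLp.toLp 2 (WithLp.toLp 2 (0, lp.single 2 k 1), 0)

section DilationFamily

variable {J ι κ X Y : Type*} [DecidableEq κ]
    [NormedAddCommGroup X] [InnerProductSpace ℂ X]
    [NormedAddCommGroup Y] [InnerProductSpace ℂ Y]
    (f : J → WithLp 2 (X × Y))
    (b : HilbertBasis ι ℂ (Submodule.span ℂ (Set.range f))ᗮ)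

theorem inner_dilationFamily_inl_inr (j : J) (t : ι ⊕ κ) :
    inner ℂ (dilationFamily (fun j => (f j).ofLp) (fun i => (b i).1.ofLp) (.inl j))
      (dilationFamily (fun j => (f j).ofLp) (fun i => (b i).1.ofLp) (.inr t)) = 0 := by
  rcases t with i | k
  · have := (Submodule.mem_orthogonal _ _).1 (b i).2 (f j) (Submodule.subset_span ⟨j, rfl⟩)
    simpa [dilationFamily, WithLp.prod_inner_apply] using this
  · simp [dilationFamily, WithLp.prod_inner_apply]

theorem inner_dilationFamily_inr_inr [DecidableEq ι] (s t : ι ⊕ κ) :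
    inner ℂ (dilationFamily (fun j => (f j).ofLp) (fun i => (b i).1.ofLp) (.inr s))
      (dilationFamily (fun j => (f j).ofLp) (fun i => (b i).1.ofLp) (.inr t)) =
      if s = t then 1 else 0 := by
  rcases s with i | k <;> rcases t with i' | k'
  · have := (orthonormal_iff_ite.1 b.orthonormal) i i'
    simpa [dilationFamily, WithLp.prod_inner_apply] using this
  · simp [dilationFamily, WithLp.prod_inner_apply]
  · simp [dilationFamily, WithLp.prod_inner_apply]
  · simp [dilationFamily, WithLp.prod_inner_apply, lp.inner_single_left, lp.single_apply,
      Pi.single_apply]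

/-- An orthogonal vector has no ℓ² component. Its remaining part is orthogonal to `f`, hence lies in
the complement spanned by `b`, and is orthogonal to `b` as well. -/
theorem span_dilationFamily_orthogonal :
    (Submodule.span ℂ (Set.range (dilationFamily (κ := κ) (fun j => (f j).ofLp)
      (fun i => (b i).1.ofLp))))ᗮ = ⊥ := by
  rw [Submodule.eq_bot_iff]
  intro v hv
  have hv' : ∀ t, inner ℂ (dilationFamily (κ := κ) (fun j => (f j).ofLp)
      (fun i => (b i).1.ofLp) t) v = 0 := fun t =>
    (Submodule.mem_orthogonal _ _).1 hv _ (Submodule.subset_span ⟨t, rfl⟩)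
  have h2 : v.fst.snd = 0 := by
    ext k
    have := hv' (.inr (.inr k))
    simpa [dilationFamily, WithLp.prod_inner_apply, lp.inner_single_left] using this
  have h1 : WithLp.toLp 2 (v.fst.fst, v.snd) = 0 := by
    have hmem : WithLp.toLp 2 (v.fst.fst, v.snd) ∈ (Submodule.span ℂ (Set.range f))ᗮ := by
      rw [Submodule.mem_orthogonal]
      intro u hu
      induction hu using Submodule.span_induction with
      | mem u hu =>
        obtain ⟨j, rfl⟩ := hu
        have := hv' (.inl j)
        simpa [dilationFamily, WithLp.prod_inner_apply, h2] using this
      | zero => simp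
      | add x y _ _ hx hy => rw [inner_add_left, hx, hy, add_zero]
      | smul a x _ hx => rw [inner_smul_left, hx, mul_zero]
    have h0 : (⟨_, hmem⟩ : (Submodule.span ℂ (Set.range f))ᗮ) = 0 := by
      apply b.repr.injective
      ext i
      rw [HilbertBasis.repr_apply_apply]
      have := hv' (.inr (.inl i))
      simpa [dilationFamily, WithLp.prod_inner_apply, h2] using this
    exact congrArg Subtype.val h0
  have h3 : v.fst.fst = 0 := congrArg WithLp.fst h1
  have h4 : v.snd = 0 := congrArg WithLp.snd h1
  apply WithLp.ofLp_injective
  refine Prod.ext (WithLp.ofLp_injective 2 (Prod.ext h3 h2)) h4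

end DilationFamily

/-- `A ⊕ ℕ × (A ⊕ B)` absorbs its first summand. -/
def sumNatProdSumEquiv (A B : Type*) : A ⊕ ℕ × (A ⊕ B) ≃ ℕ × (A ⊕ B) :=
  -- Hilbert's hotel: the extra copy of `A` is one more copy in a sequence of copies.
  let e : A ⊕ ℕ × A ≃ ℕ × A :=
    ((Equiv.sumCongr (Equiv.punitProd.{0} A).symm (Equiv.refl _)).trans
      (Equiv.sumProdDistrib PUnit.{1} ℕ A).symm).trans
      (Equiv.prodCongr ((Equiv.sumComm _ _).trans Equiv.natSumPUnitEquivNat) (Equiv.refl A))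
  (Equiv.sumCongr (Equiv.refl A) (Equiv.prodSumDistrib ℕ A B)).trans
    (((Equiv.sumAssoc _ _ _).symm.trans (Equiv.sumCongr e (Equiv.refl _))).trans
      (Equiv.prodSumDistrib ℕ A B).symm)

/-- Families with the same Gram matrix, in `X ⊕ Y` and in `X ⊕ U`, are matched by a unitary
operator after enlarging `X`. -/
theorem exists_unitary_dilation {J : Type*} {X : Type u} {Y : Type v} {U : Type w}
    [NormedAddCommGroup X] [InnerProductSpace ℂ X] [CompleteSpace X]
    [NormedAddCommGroup Y] [InnerProductSpace ℂ Y] [CompleteSpace Y]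
    [NormedAddCommGroup U] [InnerProductSpace ℂ U] [CompleteSpace U]
    (f : J → X × Y) (g : J → X × U)
    (hfg : ∀ i j, inner ℂ (f i).1 (f j).1 + inner ℂ (f i).2 (f j).2 =
      inner ℂ (g i).1 (g j).1 + inner ℂ (g i).2 (g j).2) :
    ∃ (H : Type (max u v w)) (_ : NormedAddCommGroup H) (_ : InnerProductSpace ℂ H)
      (_ : CompleteSpace H)
      (W : WithLp 2 (WithLp 2 (X × H) × Y) ≃ₗᵢ[ℂ] WithLp 2 (WithLp 2 (X × H) × U)),
      ∀ j, W (WithLp.toLp 2 (WithLp.toLp 2 ((f j).1, 0), (f j).2)) =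
        WithLp.toLp 2 (WithLp.toLp 2 ((g j).1, 0), (g j).2) := by
  classical
  let F : J → WithLp 2 (X × Y) := fun j => WithLp.toLp 2 (f j)
  let G : J → WithLp 2 (X × U) := fun j => WithLp.toLp 2 (g j)
  obtain ⟨ι₁, b₁, -⟩ := exists_hilbertBasis ℂ (Submodule.span ℂ (Set.range F))ᗮ
  obtain ⟨ι₂, b₂, -⟩ := exists_hilbertBasis ℂ (Submodule.span ℂ (Set.range G))ᗮ
  -- The complements of the two spans may differ in dimension. With this `κ`, both ι₁ ⊕ κ and ι₂ ⊕ κ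
  -- are equivalent to κ, so adding ℓ²(κ) makes the dimensions agree.
  let κ := ℕ × (ι₁ ⊕ ι₂)
  let σ : ι₁ ⊕ κ ≃ ι₂ ⊕ κ := (sumNatProdSumEquiv ι₁ ι₂).trans
    ((Equiv.sumCongr (Equiv.refl ι₂)
      (Equiv.prodCongr (Equiv.refl ℕ) (Equiv.sumComm ι₁ ι₂))).trans
      ((sumNatProdSumEquiv ι₂ ι₁).trans
        (Equiv.prodCongr (Equiv.refl ℕ) (Equiv.sumComm ι₂ ι₁)))).symm
  suffices h : ∃ W : WithLp 2 (WithLp 2 (X × lp (fun _ : κ => ℂ) 2) × Y) ≃ₗᵢ[ℂ]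
      WithLp 2 (WithLp 2 (X × lp (fun _ : κ => ℂ) 2) × U), ∀ t,
      W (dilationFamily (κ := κ) (fun j => (F j).ofLp) (fun i => (b₁ i).1.ofLp) t) =
        (dilationFamily (κ := κ) (fun j => (G j).ofLp) (fun i => (b₂ i).1.ofLp) ∘
          Sum.map id σ) t by
    obtain ⟨W, hW⟩ := h
    exact ⟨lp (fun _ : κ => ℂ) 2, inferInstance, inferInstance, inferInstance, W,
      fun j => hW (.inl j)⟩
  refine exists_unitary_of_gram _ _ ?_ (span_dilationFamily_orthogonal F b₁) ?_
  · rintro (i | s) (j | t)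
    · simpa [dilationFamily, WithLp.prod_inner_apply, F, G] using hfg i j
    · simp only [Function.comp_apply, Sum.map_inl, Sum.map_inr]
      rw [inner_dilationFamily_inl_inr, inner_dilationFamily_inl_inr]
    · simp only [Function.comp_apply, Sum.map_inl, Sum.map_inr]
      rw [← inner_conj_symm, inner_dilationFamily_inl_inr, ← inner_conj_symm,
        inner_dilationFamily_inl_inr]
    · simp only [Function.comp_apply, Sum.map_inr]
      rw [inner_dilationFamily_inr_inr, inner_dilationFamily_inr_inr]
      simp
  · rw [Function.Surjective.range_comp (Function.Surjective.sumMap Function.surjective_id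
      σ.surjective)]
    exact span_dilationFamily_orthogonal G b₂

/-! ### The GNS construction for positive families of functionals -/

/-- A family of functionals `φ p q` with `∑ φ (pₖ) (pₗ) (aₖ* aₗ) ≥ 0`. -/
def IsPositiveFamily {I A : Type*} [NonUnitalSemiring A] [StarRing A] [Module ℂ A]
    (φ : I → I → A →ₗ[ℂ] ℂ) : Prop :=
  SumNonneg fun s t : I × A => φ s.1 t.1 (star s.2 * t.2)

theorem IsPositiveFamily.conj_symm {I A : Type*} [CStarAlgebra A]
    {φ : I → I → A →ₗ[ℂ] ℂ} (hφ : IsPositiveFamily φ) (p q : I) (a b : A) :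
    starRingEnd ℂ (φ p q (star a * b)) = φ q p (star b * a) :=
  SumNonneg.conj_symm hφ (fun s => (s.1, Complex.I • s.2)) (fun s t => by simp)
    (fun s t => by simp) (p, a) (q, b)

theorem continuousLinearMap_completion_ext {E F : Type*} [SeminormedAddCommGroup E]
    [NormedSpace ℂ E] [NormedAddCommGroup F] [NormedSpace ℂ F]
    {T S : UniformSpace.Completion E →L[ℂ] F} (h : ∀ x : E, T x = S x) : T = S :=
  ContinuousLinearMap.coeFn_injective (UniformSpace.Completion.ext T.continuous S.continuous h)

/-- A `*`-representation by bounded operators on a semi-inner product space extends to the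
completion. -/
def completionRep {A E : Type*} [CStarAlgebra A] [SeminormedAddCommGroup E]
    [InnerProductSpace ℂ E] (L : A → E →L[ℂ] E)
    (smul : ∀ (r : ℂ) c x, L (r • c) x = r • L c x) (add : ∀ c d x, L (c + d) x = L c x + L d x)
    (mul : ∀ c d x, L (c * d) x = L c (L d x))
    (star_inner : ∀ c x y, inner ℂ (L c x) y = inner ℂ x (L (star c) y)) :
    A →⋆ₙₐ[ℂ] (UniformSpace.Completion E →L[ℂ] UniformSpace.Completion E) where
  toFun c := (L c).completion
  map_smul' r c := continuousLinearMap_completion_ext fun x => by simp [smul]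
  map_zero' := continuousLinearMap_completion_ext fun x => by
    have : L 0 x = 0 := by simpa using smul 0 0 x
    rw [ContinuousLinearMap.completion_apply_coe, this]
    exact UniformSpace.Completion.coe_zero
  map_add' c d := continuousLinearMap_completion_ext fun x => by
    simp [add, UniformSpace.Completion.coe_add]
  map_mul' c d := continuousLinearMap_completion_ext fun x => by simp [mul]
  map_star' c := by
    rw [ContinuousLinearMap.star_eq_adjoint, ContinuousLinearMap.eq_adjoint_iff]
    intro x y
    induction x, y using UniformSpace.Completion.induction_on₂ with
    | hp => apply isClosed_eq <;> fun_prop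
    | ih f g => simp [star_inner]

section Form

variable {I A : Type*} [CStarAlgebra A] (φ : I → I → A →ₗ[ℂ] ℂ)

/-- The semi-inner product of `φ` on finitely supported `A`-valued functions. -/
def gnsForm (f g : I →₀ A) : ℂ := f.sum fun p a => g.sum fun q b => φ p q (star a * b)

/-- Pointwise left multiplication. -/
def finsuppMulLeft (c : A) : (I →₀ A) →ₗ[ℂ] (I →₀ A) :=
  Finsupp.mapRange.linearMap (LinearMap.mulLeft ℂ c)

theorem gnsForm_add_left (f g h : I →₀ A) :
    gnsForm φ (f + g) h = gnsForm φ f h + gnsForm φ g h := by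
  refine Finsupp.sum_add_index' (fun p => by simp) fun p a b => ?_
  simp [add_mul, Finsupp.sum_add]

theorem gnsForm_smul_left (f g : I →₀ A) (r : ℂ) :
    gnsForm φ (r • f) g = starRingEnd ℂ r * gnsForm φ f g := by
  rw [gnsForm, Finsupp.sum_smul_index' (fun p => by simp)]
  simp [gnsForm, Finsupp.mul_sum]

theorem gnsForm_mulLeft_right (c : A) (f g : I →₀ A) : gnsForm φ f (finsuppMulLeft c g) =
    f.sum fun p a => g.sum fun q b => φ p q (star a * (c * b)) := by
  refine Finsupp.sum_congr fun p _ => ?_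
  exact Finsupp.sum_mapRange_index (hf := mul_zero c) (fun q => by simp)

theorem gnsForm_mulLeft_left (c : A) (f g : I →₀ A) :
    gnsForm φ (finsuppMulLeft c f) g = gnsForm φ f (finsuppMulLeft (star c) g) := by
  rw [gnsForm_mulLeft_right]
  refine (Finsupp.sum_mapRange_index (hf := mul_zero c) (fun q => by simp)).trans ?_
  simp [mul_assoc]

variable {φ}

theorem IsPositiveFamily.gnsForm_symm (hφ : IsPositiveFamily φ) (f g : I →₀ A) :
    starRingEnd ℂ (gnsForm φ g f) = gnsForm φ f g := by
  rw [gnsForm, Finsupp.sum_comm]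
  simp only [map_finsuppSum, hφ.conj_symm, gnsForm]

theorem IsPositiveFamily.gnsForm_nonneg (hφ : IsPositiveFamily φ) (f : I →₀ A) :
    0 ≤ gnsForm φ f f :=
  hφ.finset f.support fun p => (p, f p)

end Form

/-- The space of finitely supported `A`-valued functions, with the semi-inner product of `φ`. -/
@[nolint unusedArguments]
def PreGNS {I A : Type*} [CStarAlgebra A] {φ : I → I → A →ₗ[ℂ] ℂ}
    (_ : IsPositiveFamily φ) : Type _ := I →₀ A

namespace PreGNS

variable {I A : Type*} [CStarAlgebra A] {φ : I → I → A →ₗ[ℂ] ℂ} (hφ : IsPositiveFamily φ)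

instance : AddCommGroup (PreGNS hφ) := inferInstanceAs (AddCommGroup (I →₀ A))
instance : Module ℂ (PreGNS hφ) := inferInstanceAs (Module ℂ (I →₀ A))

/-- The semi-inner product. -/
abbrev core : PreInnerProductSpace.Core ℂ (PreGNS hφ) where
  inner f g := gnsForm φ f g
  conj_inner_symm f g := hφ.gnsForm_symm f g
  re_inner_nonneg f := (Complex.le_def.1 (hφ.gnsForm_nonneg f)).1
  add_left f g h := gnsForm_add_left φ f g h
  smul_left f g r := gnsForm_smul_left φ f g r

instance : SeminormedAddCommGroup (PreGNS hφ) :=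
  InnerProductSpace.Core.toSeminormedAddCommGroup (c := core hφ)
instance : InnerProductSpace ℂ (PreGNS hφ) := InnerProductSpace.ofCore (core hφ)

/-- Pointwise left multiplication. -/
def mulLeft (c : A) : PreGNS hφ →ₗ[ℂ] PreGNS hφ := finsuppMulLeft (I := I) c

theorem mulLeft_inner (c : A) (f g : PreGNS hφ) :
    inner ℂ (mulLeft hφ c f) g = inner ℂ f (mulLeft hφ (star c) g) :=
  gnsForm_mulLeft_left φ c f g

theorem mulLeft_mulLeft (c d : A) (f : PreGNS hφ) :
    mulLeft hφ c (mulLeft hφ d f) = mulLeft hφ (c * d) f := by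
  refine Finsupp.ext fun p => ?_
  exact (mul_assoc _ _ _).symm

theorem mulLeft_one (f : PreGNS hφ) : mulLeft hφ 1 f = f :=
  Finsupp.ext fun _ => one_mul _

theorem mulLeft_add (c d : A) (f : PreGNS hφ) :
    mulLeft hφ (c + d) f = mulLeft hφ c f + mulLeft hφ d f :=
  Finsupp.ext fun _ => add_mul _ _ _

theorem mulLeft_sub (c d : A) (f : PreGNS hφ) :
    mulLeft hφ (c - d) f = mulLeft hφ c f - mulLeft hφ d f :=
  Finsupp.ext fun _ => sub_mul _ _ _

theorem mulLeft_smul (r : ℂ) (c : A) (f : PreGNS hφ) :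
    mulLeft hφ (r • c) f = r • mulLeft hφ c f :=
  Finsupp.ext fun _ => smul_mul_assoc _ _ _

/-- Write ‖c‖² - c* c = b* b; then ‖c‖²‖f‖² - ‖c f‖² = ‖b f‖² ≥ 0. -/
theorem norm_mulLeft_le (c : A) (f : PreGNS hφ) : ‖mulLeft hφ c f‖ ≤ ‖c‖ * ‖f‖ := by
  let _ := CStarAlgebra.spectralOrder A
  have _ := CStarAlgebra.spectralOrderedRing A
  have h1 : star c * c ≤ ((‖c‖ ^ 2 : ℝ) : ℂ) • (1 : A) := by
    have := CStarAlgebra.star_mul_le_algebraMap_norm_sq (a := c)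
    rw [Algebra.algebraMap_eq_smul_one] at this
    rwa [Complex.coe_smul]
  obtain ⟨b, hb⟩ := CStarAlgebra.nonneg_iff_eq_star_mul_self.1 (sub_nonneg.2 h1)
  have h2 : 0 ≤ RCLike.re (inner ℂ (mulLeft hφ b f) (mulLeft hφ b f)) := inner_self_nonneg
  rw [mulLeft_inner, mulLeft_mulLeft, ← hb, mulLeft_sub, mulLeft_smul, mulLeft_one,
    inner_sub_right, inner_smul_right, ← mulLeft_mulLeft, ← mulLeft_inner, map_sub,
    inner_self_eq_norm_sq, ← RCLike.ofReal_eq_complex_ofReal, RCLike.re_ofReal_mul, inner_self_eq_norm_sq, ← mul_pow] at h2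
  exact le_of_sq_le_sq (by linarith) (by positivity)

/-- Left multiplication as a bounded operator. -/
def mulLeftL (c : A) : PreGNS hφ →L[ℂ] PreGNS hφ :=
  (mulLeft hφ c).mkContinuous ‖c‖ (norm_mulLeft_le hφ c)

theorem mulLeftL_apply (c : A) (f : PreGNS hφ) : mulLeftL hφ c f = mulLeft hφ c f := rfl

/-- The representation by left multiplication on the completion. -/
def rep : A →⋆ₙₐ[ℂ] (UniformSpace.Completion (PreGNS hφ) →L[ℂ]
    UniformSpace.Completion (PreGNS hφ)) :=
  completionRep (mulLeftL hφ) (fun r c => mulLeft_smul hφ r c) (fun c d => mulLeft_add hφ c d)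
    (fun c d f => (mulLeft_mulLeft hφ c d f).symm) (fun c f g => mulLeft_inner hφ c f g)

theorem rep_one : rep hφ 1 = 1 :=
  continuousLinearMap_completion_ext fun x => by
    change (mulLeftL hφ 1).completion x = x
    rw [ContinuousLinearMap.completion_apply_coe, mulLeftL_apply, mulLeft_one]

/-- The cyclic vectors. -/
def vec (p : I) : UniformSpace.Completion (PreGNS hφ) :=
  UniformSpace.Completion.coe' (show PreGNS hφ from Finsupp.single p (1 : A))

theorem inner_vec_rep_vec (p q : I) (a : A) :
    inner ℂ (vec hφ p) (rep hφ a (vec hφ q)) = φ p q a := by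
  change inner ℂ (vec hφ p) ((mulLeftL hφ a).completion (vec hφ q)) = φ p q a
  rw [vec, vec, ContinuousLinearMap.completion_apply_coe, UniformSpace.Completion.inner_coe]
  refine (gnsForm_mulLeft_right φ a _ _).trans ?_
  refine (Finsupp.sum_single_index (by simp)).trans ?_
  refine (Finsupp.sum_single_index (by simp)).trans ?_
  simp

end PreGNS

/-! ### The cone of kernels with an Agler decomposition -/

theorem IsPositiveFamily.apply_nonneg {I X : Type*} [TopologicalSpace X]
    {φ : I → I → (X →ᵇ ℂ) →ₗ[ℂ] ℂ} (hφ : IsPositiveFamily φ) (p : I) (a : X →ᵇ ℂ)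
    (ha : ∀ x, 0 ≤ a x) : 0 ≤ φ p p a := by
  obtain ⟨s, rfl⟩ := exists_eq_star_mul_self a ha
  simpa using hφ 1 (fun _ => (p, s))

theorem IsPositiveFamily.add {I A : Type*} [CStarAlgebra A] {φ χ : I → I → A →ₗ[ℂ] ℂ}
    (hφ : IsPositiveFamily φ) (hχ : IsPositiveFamily χ) : IsPositiveFamily (φ + χ) := by
  intro n t
  have := add_nonneg (hφ n t) (hχ n t)
  simpa [Finset.sum_add_distrib] using this

theorem IsPositiveFamily.smul {I A : Type*} [CStarAlgebra A] {φ : I → I → A →ₗ[ℂ] ℂ}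
    (hφ : IsPositiveFamily φ) {r : ℝ} (hr : 0 ≤ r) :
    IsPositiveFamily (fun p q => (r : ℂ) • φ p q) := by
  intro n t
  have := mul_nonneg (Complex.zero_le_real.2 hr) (hφ n t)
  simpa [Finset.mul_sum] using this

/-- Boundedness of the functionals of a positive family in terms of the diagonal. -/
theorem IsPositiveFamily.norm_apply_le {I X : Type*} [TopologicalSpace X]
    {φ : I → I → (X →ᵇ ℂ) →ₗ[ℂ] ℂ} (hφ : IsPositiveFamily φ) (p q : I) (a : X →ᵇ ℂ) :
    2 * ‖φ p q a‖ ≤ (φ p p 1).re + ‖a‖ ^ 2 * (φ q q 1).re := by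
  obtain ⟨c, hc, hc'⟩ : ∃ c : ℂ, ‖c‖ = 1 ∧ c * φ p q a = ‖φ p q a‖ := by
    by_cases h : φ p q a = 0
    · exact ⟨1, by simp, by simp [h]⟩
    · refine ⟨‖φ p q a‖ / φ p q a, ?_, ?_⟩
      · simp [h]
      · field_simp
  -- The unimodular `c` rotates φ p q a to its modulus, so positivity reads φ p p 1 - 2|φ p q a| + φ
  -- q q (a* a) ≥ 0. The last term is bounded through a* a ≤ ‖a‖².
  have h1 := (Complex.le_def.1 (hφ 2 ![(p, 1), (q, -c • a)])).1
  have h2 : φ q p (star a) = starRingEnd ℂ (φ p q a) := by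
    have := hφ.conj_symm p q 1 a
    simpa using this.symm
  have h3 : φ q q (star (c • a) * (c • a)) = φ q q (star a * a) := by
    have : star c * c = 1 := by
      rw [Complex.star_def, ← Complex.normSq_eq_conj_mul_self, Complex.normSq_eq_norm_sq, hc]
      simp
    rw [star_smul, smul_mul_smul_comm, this, one_smul]
  have h4 := (Complex.le_def.1 (hφ.apply_nonneg q (((‖a‖ ^ 2 : ℝ) : ℂ) • 1 - star a * a)
    (fun x => by
      have hx := a.norm_coe_le_norm x
      have : star (a x) * a x = ((‖a x‖ ^ 2 : ℝ) : ℂ) := by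
        rw [Complex.star_def, ← Complex.normSq_eq_conj_mul_self, Complex.normSq_eq_norm_sq]
      simp only [BoundedContinuousFunction.sub_apply, BoundedContinuousFunction.smul_apply,
        BoundedContinuousFunction.mul_apply, BoundedContinuousFunction.star_apply, this,
        BoundedContinuousFunction.coe_one, Pi.one_apply, smul_eq_mul, mul_one]
      rw [← Complex.ofReal_sub, Complex.zero_le_real]
      have := pow_le_pow_left₀ (norm_nonneg _) hx 2
      linarith))).1
  rw [map_sub, map_smul, smul_eq_mul, Complex.sub_re, Complex.re_ofReal_mul] at h4
  have h5 : starRingEnd ℂ c * starRingEnd ℂ (φ p q a) = ‖φ p q a‖ := by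
    rw [← map_mul, hc']; simp
  have h6 : φ p q (c • a) = ‖φ p q a‖ := by rw [map_smul, smul_eq_mul, hc']
  have h7 : φ q p (star (c • a)) = ‖φ p q a‖ := by
    rw [star_smul, map_smul, h2, smul_eq_mul, ← h5, Complex.star_def]
  rw [neg_smul] at h1
  generalize c • a = b at h1 h3 h6 h7
  simp only [Fin.sum_univ_two, Matrix.cons_val_zero, Matrix.cons_val_one, star_neg,
    neg_mul_neg, h3, star_one, one_mul, mul_one, map_neg, h6, h7] at h1
  simp at h1 h4
  linarith

section AglerCone

variable {Ω : Type u} {Ψ : Set (Ω → ℂ)} (hΨ : IsTestFunctions Ψ) {I : Type*} (p : I → Ω)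

/-- The functions `1 - E(x) E(y)*`. -/
def defect (x y : Ω) : Cb Ψ := 1 - evalE hΨ x * star (evalE hΨ y)

theorem defect_apply (x y : Ω) (ψ : Ψ) :
    defect hΨ x y ψ = 1 - ψ.1 x * starRingEnd ℂ (ψ.1 y) := rfl

/-- The kernels `φ i j (1 - E(pᵢ) E(pⱼ)*)` with `φ` a positive family. -/
def aglerCone : Set (I × I → ℂ) :=
  {M | ∃ φ : I → I → Cb Ψ →ₗ[ℂ] ℂ, IsPositiveFamily φ ∧
    ∀ i j, M (i, j) = φ i j (defect hΨ (p i) (p j))}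

/-- At each point, `1 - |E(x)|²` is bounded below, uniformly in the positive family. -/
theorem exists_diag_le (x : Ω) : ∃ r : ℝ, 0 < r ∧
    ∀ (φ : I → I → Cb Ψ →ₗ[ℂ] ℂ), IsPositiveFamily φ →
      ∀ i, r * (φ i i 1).re ≤ (φ i i (defect hΨ x x)).re := by
  obtain ⟨r, hr, h⟩ := hΨ.sup_lt_one x
  -- A negative `r` can occur when `Ψ` is empty, so `r` itself cannot be squared.
  have hr' : (max r 0) ^ 2 < 1 := by
    have : max r 0 < 1 := max_lt hr one_pos
    have h0 : 0 ≤ max r 0 := le_max_right _ _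
    nlinarith
  refine ⟨1 - (max r 0) ^ 2, by linarith, fun φ hφ i => ?_⟩
  have h4 := (Complex.le_def.1 (hφ.apply_nonneg i
    (defect hΨ x x - ((1 - (max r 0) ^ 2 : ℝ) : ℂ) • 1) (fun ψ => by
      have hx := (h ψ.1 ψ.2).trans (le_max_left r 0)
      rw [BoundedContinuousFunction.sub_apply, defect_apply, Complex.mul_conj,
        Complex.normSq_eq_norm_sq, BoundedContinuousFunction.smul_apply,
        BoundedContinuousFunction.coe_one, Pi.one_apply, smul_eq_mul, mul_one, ← Complex.ofReal_one,
        ← Complex.ofReal_sub, ← Complex.ofReal_sub, Complex.zero_le_real]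
      have := pow_le_pow_left₀ (norm_nonneg _) hx 2
      linarith))).1
  rw [map_sub, map_smul, smul_eq_mul, Complex.sub_re, Complex.re_ofReal_mul] at h4
  simpa using h4

theorem convex_aglerCone : Convex ℝ (aglerCone hΨ p) := by
  rintro M ⟨φ, hφ, hM⟩ N ⟨χ, hχ, hN⟩ a b ha hb -
  refine ⟨_, (hφ.smul ha).add (hχ.smul hb), fun i j => ?_⟩
  simp [hM, hN]

-- Along an ultrafilter in the cone converging to M, the diagonal entries bound φ i i 1 by
-- `exists_diag_le`, and then every φ i j a by `norm_apply_le`. The ultrafilter limits of these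
-- bounded values form a positive family representing M.
open Filter Topology in
theorem isClosed_aglerCone : IsClosed (aglerCone hΨ p) := by
  classical
  rw [← closure_subset_iff_isClosed]
  intro M hM
  obtain ⟨𝒰, h𝒰, hlim⟩ := mem_closure_iff_ultrafilter.1 hM
  choose! φ hφ hφM using fun (N : I × I → ℂ) (hN : N ∈ aglerCone hΨ p) => hN
  have hdiag : ∀ i, ∃ B : ℝ, ∀ᶠ N in (𝒰 : Filter (I × I → ℂ)), (φ N i i 1).re ≤ B := by
    intro i
    obtain ⟨r, hr, h⟩ := exists_diag_le (I := I) hΨ (p i)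
    refine ⟨(‖M (i, i)‖ + 1) / r, ?_⟩
    have hc : Tendsto (fun N : I × I → ℂ => ‖N (i, i)‖) 𝒰 (𝓝 ‖M (i, i)‖) :=
      (((continuous_apply (i, i)).norm).tendsto M).mono_left hlim
    filter_upwards [hc.eventually_lt_const (lt_add_one _), h𝒰] with N h1 h2
    rw [le_div_iff₀ hr]
    have h3 := h (φ N) (hφ N h2) i
    rw [← hφM N h2] at h3
    have := Complex.re_le_norm (N (i, i))
    linarith
  have hex : ∀ i j a, ∃ z : ℂ, Tendsto (fun N => φ N i j a) 𝒰 (𝓝 z) := by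
    intro i j a
    obtain ⟨B, hB⟩ := hdiag i
    obtain ⟨B', hB'⟩ := hdiag j
    have hball : ∀ᶠ N in (𝒰 : Filter (I × I → ℂ)),
        φ N i j a ∈ Metric.closedBall (0 : ℂ) (B + ‖a‖ ^ 2 * B') := by
      filter_upwards [hB, hB', h𝒰] with N h1 h2 h3
      rw [mem_closedBall_zero_iff]
      have h4 := (hφ N h3).norm_apply_le i j a
      have h5 := mul_le_mul_of_nonneg_left h2 (sq_nonneg ‖a‖)
      have := norm_nonneg (φ N i j a)
      linarith
    obtain ⟨z, -, hz⟩ := (isCompact_closedBall (0 : ℂ) (B + ‖a‖ ^ 2 * B')).ultrafilter_le_nhds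
      (𝒰.map fun N => φ N i j a) (le_principal_iff.2 hball)
    exact ⟨z, hz⟩
  choose χ hχ using hex
  refine ⟨fun i j =>
    { toFun := χ i j
      map_add' := fun a b => tendsto_nhds_unique (hχ i j (a + b)) (by
        simpa using (hχ i j a).add (hχ i j b))
      map_smul' := fun c a => tendsto_nhds_unique (hχ i j (c • a)) (by
        simpa using (hχ i j a).const_mul c) }, fun n t => ?_, fun i j => ?_⟩
  · have : Tendsto (fun N => ∑ k, ∑ l, φ N (t k).1 (t l).1 (star (t k).2 * (t l).2)) 𝒰
        (𝓝 (∑ k, ∑ l, χ (t k).1 (t l).1 (star (t k).2 * (t l).2))) :=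
      tendsto_finsetSum _ fun k _ => tendsto_finsetSum _ fun l _ => hχ _ _ _
    refine ge_of_tendsto this ?_
    filter_upwards [h𝒰] with N hN
    exact hφ N hN n t
  · refine tendsto_nhds_unique (((continuous_apply (i, j)).tendsto M).mono_left hlim) ?_
    refine (hχ i j _).congr' ?_
    filter_upwards [h𝒰] with N hN
    exact (hφM N hN i j).symm

/-- A basic neighbourhood of 0 on which |f| < 1 constrains finitely many coordinates. If those
vanish on M, all multiples of M lie in it, which forces f M = 0. -/
theorem exists_finset_apply_eq_sum {J : Type*} [DecidableEq J] (f : (J → ℂ) →L[ℂ] ℂ) :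
    ∃ s : Finset J, (∀ j ∉ s, f (Pi.single j 1) = 0) ∧
      ∀ M, f M = ∑ j ∈ s, M j * f (Pi.single j 1) := by
  have h0 : f ⁻¹' Metric.ball 0 1 ∈ nhds (0 : J → ℂ) :=
    f.continuous.continuousAt.preimage_mem_nhds (by simpa using Metric.ball_mem_nhds 0 one_pos)
  rw [nhds_pi, Filter.mem_pi] at h0
  obtain ⟨s, hs, t, ht, hsub⟩ := h0
  have hvan : ∀ M : J → ℂ, (∀ j ∈ s, M j = 0) → f M = 0 := by
    intro M hM
    by_contra hne
    have h1 : ((f M)⁻¹ • M) ∈ f ⁻¹' Metric.ball 0 1 := by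
      refine hsub fun j hj => ?_
      simpa [hM j hj] using mem_of_mem_nhds (ht j)
    simp [hne] at h1
  refine ⟨hs.toFinset, fun j hj => hvan _ fun i hi => ?_, fun M => ?_⟩
  · have : i ≠ j := fun h => hj (by simpa [← h] using hi)
    simp [this]
  · have h2 := hvan (M - ∑ j ∈ hs.toFinset, M j • Pi.single j 1) fun i hi => by
      simp [Finset.sum_apply, Pi.single_apply, hi]
    rw [map_sub, sub_eq_zero] at h2
    simpa using h2

/-- Evaluation at a test function gives elements of the cone. -/
theorem eval_mem_aglerCone (w : I → ℂ) (ψ : Ψ) :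
    (fun ij : I × I => starRingEnd ℂ (w ij.1) * w ij.2 * defect hΨ (p ij.1) (p ij.2) ψ) ∈
      aglerCone hΨ p := by
  refine ⟨fun i j => (starRingEnd ℂ (w i) * w j) •
    (BoundedContinuousFunction.evalCLM ℂ ψ : Cb Ψ →L[ℂ] ℂ).toLinearMap, fun n t => ?_,
    fun i j => by simp⟩
  have : ∑ k, ∑ l, starRingEnd ℂ (w (t k).1) * w (t l).1 * (star ((t k).2 ψ) * (t l).2 ψ) =
      starRingEnd ℂ (∑ k, w (t k).1 * (t k).2 ψ) * ∑ k, w (t k).1 * (t k).2 ψ := by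
    rw [map_sum, Finset.sum_mul_sum]
    refine Finset.sum_congr rfl fun k _ => Finset.sum_congr rfl fun l _ => ?_
    rw [map_mul, Complex.star_def]
    ring
  have h2 := star_mul_self_nonneg (∑ k, w (t k).1 * (t k).2 ψ)
  rw [Complex.star_def, ← this] at h2
  simpa using h2

/-- A Hermitian kernel which is nonnegative on all finitely supported admissible functionals
has an Agler decomposition. -/
theorem mem_aglerCone_of_forall (T : I × I → ℂ) (hT : ∀ i j, starRingEnd ℂ (T (i, j)) = T (j, i))
    (h : ∀ (s : Finset I) (c : I → I → ℂ), (∀ i j, i ∉ s ∨ j ∉ s → c i j = 0) →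
      (∀ ψ ∈ Ψ, SumNonneg fun a b : I × ℂ => starRingEnd ℂ a.2 * b.2 * c a.1 b.1 *
        (1 - ψ (p a.1) * starRingEnd ℂ (ψ (p b.1)))) →
      0 ≤ (∑ i ∈ s, ∑ j ∈ s, c i j * T (i, j)).re) : T ∈ aglerCone hΨ p := by
  classical
  by_contra hmem
  obtain ⟨f, r, hr, hf⟩ := RCLike.geometric_hahn_banach_point_closed (𝕜 := ℂ)
    (convex_aglerCone hΨ p) (isClosed_aglerCone hΨ p) hmem
  simp only [RCLike.re_to_complex] at hr hf
  have hzero : (0 : I × I → ℂ) ∈ aglerCone hΨ p :=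
    ⟨0, fun n t => by simp, fun i j => by simp⟩
  have hr0 : r < 0 := by simpa using hf 0 hzero
  have hpos : ∀ N ∈ aglerCone hΨ p, 0 ≤ (f N).re := by
    rintro N ⟨φ, hφ, hN⟩
    by_contra! hneg
    -- Scaling `N` by this factor stays in the cone and makes the real part exactly `r`, against the
    -- strict separation.
    have hk : 0 ≤ r / (f N).re := (div_pos_of_neg_of_neg hr0 hneg).le
    have := hf (((r / (f N).re : ℝ) : ℂ) • N) ⟨_, hφ.smul hk, fun i j => by simp [hN]⟩
    rw [map_smul, smul_eq_mul, Complex.re_ofReal_mul, div_mul_cancel₀ _ hneg.ne] at this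
    exact lt_irrefl _ this
  obtain ⟨s₀, hs₀, hfs⟩ := exists_finset_apply_eq_sum f
  let c₀ : I → I → ℂ := fun i j => f (Pi.single (i, j) 1)
  let s : Finset I := s₀.image Prod.fst ∪ s₀.image Prod.snd
  have hs : ∀ i j, i ∉ s ∨ j ∉ s → c₀ i j = 0 := by
    intro i j hij
    refine hs₀ _ fun hm => ?_
    rcases hij with hi | hi
    · exact hi (Finset.mem_union_left _ (Finset.mem_image_of_mem Prod.fst hm))
    · exact hi (Finset.mem_union_right _ (Finset.mem_image_of_mem Prod.snd hm))
  have hfT : f T = ∑ i ∈ s, ∑ j ∈ s, c₀ i j * T (i, j) := by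
    rw [hfs, ← Finset.sum_product']
    refine (Finset.sum_subset ?_ fun x _ hx => by rw [hs₀ x hx, mul_zero]).trans
      (Finset.sum_congr rfl fun x _ => mul_comm _ _)
    intro x hx
    exact Finset.mem_product.2 ⟨Finset.mem_union_left _ (Finset.mem_image_of_mem Prod.fst hx),
      Finset.mem_union_right _ (Finset.mem_image_of_mem Prod.snd hx)⟩
  -- The Hermitian part of the coefficients: on Hermitian kernels it computes the real part of `f`.
  let c : I → I → ℂ := fun i j => (c₀ i j + starRingEnd ℂ (c₀ j i)) / 2
  have hcT : ∑ i ∈ s, ∑ j ∈ s, c i j * T (i, j) = ((f T).re : ℂ) := by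
    rw [Complex.re_eq_add_conj, hfT]
    simp only [map_sum, map_mul, hT]
    rw [Finset.sum_comm (f := fun i j => starRingEnd ℂ (c₀ i j) * T (j, i)),
      ← Finset.sum_add_distrib, Finset.sum_div]
    refine Finset.sum_congr rfl fun i _ => ?_
    rw [← Finset.sum_add_distrib, Finset.sum_div]
    refine Finset.sum_congr rfl fun j _ => by ring
  have hneg := h s c (fun i j hij => by simp [c, hs i j hij, hs j i hij.symm]) ?_
  · rw [hcT, Complex.ofReal_re] at hneg
    linarith
  intro ψ hψ n t
  let D : I → I → ℂ := fun i j => 1 - ψ (p i) * starRingEnd ℂ (ψ (p j))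
  -- The family `t` may repeat an index; `w` collects the total coefficient at each index.
  let w : I → ℂ := fun i => ∑ k, if i = (t k).1 then (t k).2 else 0
  let N : I × I → ℂ := ∑ k, ∑ l, (starRingEnd ℂ (t k).2 * (t l).2 * D (t k).1 (t l).1) •
    Pi.single ((t k).1, (t l).1) 1
  have hN : N = fun ij : I × I =>
      starRingEnd ℂ (w ij.1) * w ij.2 * defect hΨ (p ij.1) (p ij.2) ⟨ψ, hψ⟩ := by
    ext ⟨i, j⟩
    simp only [N, w, Finset.sum_apply, Pi.smul_apply, smul_eq_mul, map_sum, Finset.sum_mul_sum,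
      defect_apply]
    simp only [Finset.sum_mul]
    refine Finset.sum_congr rfl fun k _ => Finset.sum_congr rfl fun l _ => ?_
    by_cases hi : i = (t k).1
    · by_cases hj : j = (t l).1
      · subst hi hj; simp [D]
      · simp [hj]
    · simp [hi]
  have hfN : 0 ≤ (f N).re := by
    rw [hN]; exact hpos _ (eval_mem_aglerCone hΨ p w ⟨ψ, hψ⟩)
  have hfN' : f N = ∑ k, ∑ l, (starRingEnd ℂ (t k).2 * (t l).2 * D (t k).1 (t l).1) *
      c₀ (t k).1 (t l).1 := by
    simp [N, c₀, map_sum]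
  have hD : ∀ i j, starRingEnd ℂ (D i j) = D j i := fun i j => by simp [D, mul_comm]
  have : ∑ k, ∑ l, starRingEnd ℂ (t k).2 * (t l).2 * c (t k).1 (t l).1 * D (t k).1 (t l).1 =
      ((f N).re : ℂ) := by
    rw [Complex.re_eq_add_conj, hfN']
    simp only [map_sum, map_mul, hD, Complex.conj_conj]
    rw [Finset.sum_comm (f := fun k l => (t k).2 * starRingEnd ℂ (t l).2 * D (t l).1 (t k).1 *
      starRingEnd ℂ (c₀ (t k).1 (t l).1)), ← Finset.sum_add_distrib, Finset.sum_div]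
    refine Finset.sum_congr rfl fun i _ => ?_
    rw [← Finset.sum_add_distrib, Finset.sum_div]
    refine Finset.sum_congr rfl fun j _ => by simp only [c]; ring
  rw [this]
  exact Complex.zero_le_real.2 hfN

end AglerCone

/-! ### Unitary colligations -/

namespace UnitaryColligation

variable {Ω : Type u} {Ψ : Set (Ω → ℂ)}
  {X : Type*} [NormedAddCommGroup X] [InnerProductSpace ℂ X] [CompleteSpace X]
  {U : Type*} [NormedAddCommGroup U] [InnerProductSpace ℂ U]
  {Y : Type*} [NormedAddCommGroup Y] [InnerProductSpace ℂ Y]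
  (c : UnitaryColligation Ψ X U Y)

theorem op_apply (v : X × U) : c.op v = (c.V (WithLp.toLp 2 v)).ofLp := rfl

theorem op_eq (x : X) (w : U) : c.op (x, w) = (c.A x + c.B w, c.C x + c.D w) := by
  have : ((x, w) : X × U) = (x, 0) + (0, w) := by simp
  rw [this, map_add]
  rfl

theorem inner_op (v v' : X × U) :
    inner ℂ (c.op v).1 (c.op v').1 + inner ℂ (c.op v).2 (c.op v').2 =
      inner ℂ v.1 v'.1 + inner ℂ v.2 v'.2 := by
  have := c.V.inner_map_map (WithLp.toLp 2 v) (WithLp.toLp 2 v')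
  rw [WithLp.prod_inner_apply, WithLp.prod_inner_apply] at this
  exact this

theorem norm_A_le : ‖c.A‖ ≤ 1 := by
  refine ContinuousLinearMap.opNorm_le_bound _ zero_le_one fun x => ?_
  have h := c.inner_op (x, 0) (x, 0)
  rw [op_eq] at h
  simp only [map_zero, add_zero, inner_self_eq_norm_sq_to_K] at h
  norm_cast at h
  rw [norm_zero] at h
  rw [one_mul]
  have h2 := sq_nonneg ‖c.C x‖
  exact le_of_sq_le_sq (by linarith) (norm_nonneg _)

/-- The colligation with the inverse unitary operator. -/
def symm : UnitaryColligation Ψ X Y U where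
  V := c.V.symm
  ρ := c.ρ

theorem inner_symm_op (v : X × Y) (w : X × U) :
    inner ℂ (c.symm.op v).1 w.1 + inner ℂ (c.symm.op v).2 w.2 =
      inner ℂ v.1 (c.op w).1 + inner ℂ v.2 (c.op w).2 := by
  have h : c.op (c.symm.op v) = v := by
    rw [op_apply, op_apply]
    exact congrArg WithLp.ofLp (c.V.apply_symm_apply (WithLp.toLp 2 v))
  rw [← c.inner_op, h]

theorem adjoint_A : c.A.adjoint = c.symm.A := by
  refine ((ContinuousLinearMap.eq_adjoint_iff _ _).2 fun x x' => ?_).symm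
  simpa [op_eq] using c.inner_symm_op (x, 0) (x', 0)

theorem adjoint_B [CompleteSpace U] : c.B.adjoint = c.symm.C := by
  refine ((ContinuousLinearMap.eq_adjoint_iff _ _).2 fun x x' => ?_).symm
  simpa [op_eq] using c.inner_symm_op (x, 0) (0, x')

theorem adjoint_C [CompleteSpace Y] : c.C.adjoint = c.symm.B := by
  refine ((ContinuousLinearMap.eq_adjoint_iff _ _).2 fun x x' => ?_).symm
  simpa [op_eq] using c.inner_symm_op (0, x) (x', 0)

theorem adjoint_D [CompleteSpace U] [CompleteSpace Y] : c.D.adjoint = c.symm.D := by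
  refine ((ContinuousLinearMap.eq_adjoint_iff _ _).2 fun x x' => ?_).symm
  simpa [op_eq] using c.inner_symm_op (0, x) (0, x')

theorem isUnit_one_sub_mul_A {T : X →L[ℂ] X} (hT : ‖T‖ < 1) : IsUnit (1 - T * c.A) := by
  refine isUnit_one_sub_of_norm_lt_one ((norm_mul_le _ _).trans_lt ?_)
  have := mul_le_mul_of_nonneg_left c.norm_A_le (norm_nonneg T)
  linarith

theorem isUnit_one_sub_A_mul {T : X →L[ℂ] X} (hT : ‖T‖ < 1) : IsUnit (1 - c.A * T) := by
  refine isUnit_one_sub_of_norm_lt_one ((norm_mul_le _ _).trans_lt ?_)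
  have := mul_le_mul_of_nonneg_right c.norm_A_le (norm_nonneg T)
  linarith

theorem mul_inverse_one_sub {T : X →L[ℂ] X} (hT : ‖T‖ < 1) :
    T * Ring.inverse (1 - c.A * T) = Ring.inverse (1 - T * c.A) * T := by
  have h1 := Ring.mul_inverse_cancel _ (c.isUnit_one_sub_A_mul hT)
  have h2 := Ring.inverse_mul_cancel _ (c.isUnit_one_sub_mul_A hT)
  calc T * Ring.inverse (1 - c.A * T)
      = (Ring.inverse (1 - T * c.A) * (1 - T * c.A)) * (T * Ring.inverse (1 - c.A * T)) := by
        rw [h2, one_mul]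
    _ = Ring.inverse (1 - T * c.A) * T * ((1 - c.A * T) * Ring.inverse (1 - c.A * T)) := by
        noncomm_ring
    _ = _ := by rw [h1, mul_one]

/-- The state `(1 - A T)⁻¹ B`. -/
def state (T : X →L[ℂ] X) : U →L[ℂ] X := Ring.inverse (1 - c.A * T) ∘L c.B

/-- The feedback system: x = A T x + B w is solved by the state, and the output C T x + D w agrees
with `transfer` by T (1 - A T)⁻¹ = (1 - T A)⁻¹ T. -/
theorem op_state {T : X →L[ℂ] X} (hT : ‖T‖ < 1) (w : U) :
    c.op (T (c.state T w), w) = (c.state T w, c.transfer T w) := by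
  rw [op_eq]
  refine Prod.ext ?_ ?_
  · have h1 := congrArg (fun L : X →L[ℂ] X => L (c.B w))
      (Ring.mul_inverse_cancel _ (c.isUnit_one_sub_A_mul hT))
    simp only [mul_apply_eq_comp, sub_apply, one_apply_eq_self] at h1
    change c.A (T (Ring.inverse (1 - c.A * T) (c.B w))) + c.B w =
      Ring.inverse (1 - c.A * T) (c.B w)
    exact (sub_eq_iff_eq_add'.1 h1).symm
  · have h1 := congrArg (fun L : X →L[ℂ] X => L (c.B w)) (c.mul_inverse_one_sub hT)
    simp only [mul_apply_eq_comp] at h1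
    change c.C (T (Ring.inverse (1 - c.A * T) (c.B w))) + c.D w =
      c.D w + c.C (Ring.inverse (1 - T * c.A) (T (c.B w)))
    rw [h1, add_comm]

theorem transfer_eq_of_op_eq {T : X →L[ℂ] X} (hT : ‖T‖ < 1) {h : X} {w : U} {y : Y}
    (hop : c.op (T h, w) = (h, y)) : c.transfer T w = y := by
  rw [op_eq, Prod.mk.injEq] at hop
  have h1 : (1 - T * c.A) (T h) = T (c.B w) := by
    have := congrArg T hop.1
    rw [map_add] at this
    simp only [sub_apply, one_apply_eq_self, mul_apply_eq_comp]
    rw [sub_eq_iff_eq_add', this]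
  have h2 := congrArg (fun L : X →L[ℂ] X => L (T h))
      (Ring.inverse_mul_cancel _ (c.isUnit_one_sub_mul_A hT))
  simp only [mul_apply_eq_comp, one_apply_eq_self] at h2
  rw [h1] at h2
  change c.D w + c.C (Ring.inverse (1 - T * c.A) (T (c.B w))) = y
  rw [h2, add_comm]
  exact hop.2

theorem adjoint_transfer [CompleteSpace U] [CompleteSpace Y] {T : X →L[ℂ] X} (hT : ‖T‖ < 1) :
    (c.transfer T).adjoint = c.symm.transfer T.adjoint := by
  have hT' : ‖T.adjoint‖ < 1 := by rwa [LinearIsometryEquiv.norm_map]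
  have h1 : (Ring.inverse (1 - T * c.A)).adjoint = Ring.inverse (1 - c.symm.A * T.adjoint) := by
    rw [← ContinuousLinearMap.star_eq_adjoint, ← Ring.inverse_star, star_sub, star_one, star_mul,
      ContinuousLinearMap.star_eq_adjoint, ContinuousLinearMap.star_eq_adjoint, adjoint_A]
  have h2 := c.symm.mul_inverse_one_sub hT'
  simp only [transfer, map_add, ContinuousLinearMap.adjoint_comp, adjoint_B, adjoint_C, adjoint_D,
    h1]
  congr 1
  ext w
  have h3 := congrArg (fun L : X →L[ℂ] X => c.symm.C (L (c.symm.B w))) h2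
  exact h3

/-- Polarized energy balance: V preserves inner products and carries (T x, w) to (x, transfer w). -/
theorem inner_state {T T' : X →L[ℂ] X} (hT : ‖T‖ < 1) (hT' : ‖T'‖ < 1) (w w' : U) :
    inner ℂ w w' - inner ℂ (c.transfer T w) (c.transfer T' w') =
      inner ℂ (c.state T w) (c.state T' w') -
        inner ℂ (T (c.state T w)) (T' (c.state T' w')) := by
  have := c.inner_op (T (c.state T w), w) (T' (c.state T' w'), w')
  rw [op_state _ hT, op_state _ hT'] at this
  simp only at this
  linear_combination -this

theorem norm_ρ_evalE_lt (hΨ : IsTestFunctions Ψ) (x : Ω) : ‖c.ρ (evalE hΨ x)‖ < 1 := by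
  obtain ⟨r, hr, h⟩ := hΨ.sup_lt_one x
  refine (NonUnitalStarAlgHom.norm_apply_le c.ρ _).trans_lt
    (lt_of_le_of_lt ?_ (max_lt hr one_pos))
  rw [BoundedContinuousFunction.norm_le (le_max_right r 0)]
  exact fun ψ => (h ψ.1 ψ.2).trans (le_max_left r 0)

theorem norm_adjoint_ρ_evalE_lt (hΨ : IsTestFunctions Ψ) (x : Ω) :
    ‖(c.ρ (evalE hΨ x)).adjoint‖ < 1 := by
  rw [LinearIsometryEquiv.norm_map]
  exact c.norm_ρ_evalE_lt hΨ x

/-- The term with `c.ρ 1` remains because ρ need not be unital. -/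
theorem inner_adjoint_ρ (hΨ : IsTestFunctions Ψ) (x y : Ω) (h h' : X) :
    inner ℂ ((c.ρ (evalE hΨ x)).adjoint h) ((c.ρ (evalE hΨ y)).adjoint h') =
      inner ℂ h (c.ρ 1 h') - inner ℂ h (c.ρ (defect hΨ x y) h') := by
  rw [ContinuousLinearMap.adjoint_inner_left, defect, map_sub, map_mul, map_star,
    ContinuousLinearMap.star_eq_adjoint, sub_apply, inner_sub_right]
  simp

end UnitaryColligation

/-! ### Construction of colligations -/

section SumRep

variable {A X H : Type*} [CStarAlgebra A]
    [NormedAddCommGroup X] [InnerProductSpace ℂ X]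
    [NormedAddCommGroup H] [InnerProductSpace ℂ H]

/-- The operator `T ⊕ r` on `X ⊕ H`. -/
def sumScalar (H : Type*) [NormedAddCommGroup H] [InnerProductSpace ℂ H]
    (T : X →L[ℂ] X) (r : ℂ) : WithLp 2 (X × H) →L[ℂ] WithLp 2 (X × H) :=
  ((WithLp.prodContinuousLinearEquiv 2 ℂ X H).symm : X × H →L[ℂ] WithLp 2 (X × H)) ∘L
    (T.prodMap (r • (1 : H →L[ℂ] H))) ∘L
      (WithLp.prodContinuousLinearEquiv 2 ℂ X H : WithLp 2 (X × H) →L[ℂ] X × H)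

theorem sumScalar_ext {T S : WithLp 2 (X × H) →L[ℂ] WithLp 2 (X × H)}
    (h₁ : ∀ v, (T v).fst = (S v).fst) (h₂ : ∀ v, (T v).snd = (S v).snd) : T = S :=
  ContinuousLinearMap.ext fun v => WithLp.ofLp_injective 2 (Prod.ext (h₁ v) (h₂ v))

theorem sumScalar_fst (T : X →L[ℂ] X) (r : ℂ) (v : WithLp 2 (X × H)) :
    (sumScalar H T r v).fst = T v.fst := rfl

theorem sumScalar_snd (T : X →L[ℂ] X) (r : ℂ) (v : WithLp 2 (X × H)) :
    (sumScalar H T r v).snd = r • v.snd := rfl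

variable [CompleteSpace X] [CompleteSpace H]

variable (H) in
/-- The direct sum of a representation with a character acting by scalars. -/
def sumRep (ρ : A →⋆ₙₐ[ℂ] (X →L[ℂ] X)) (χ : A →⋆ₙₐ[ℂ] ℂ) :
    A →⋆ₙₐ[ℂ] (WithLp 2 (X × H) →L[ℂ] WithLp 2 (X × H)) where
  toFun a := sumScalar H (ρ a) (χ a)
  map_smul' r a := sumScalar_ext (fun v => by simp [sumScalar_fst])
    (fun v => by simp [sumScalar_snd, mul_smul])
  map_zero' := sumScalar_ext (fun v => by simp [sumScalar_fst])
    (fun v => by simp [sumScalar_snd])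
  map_add' a b := sumScalar_ext (fun v => by simp [sumScalar_fst])
    (fun v => by simp [sumScalar_snd, add_smul])
  map_mul' a b := sumScalar_ext (fun v => by simp [sumScalar_fst])
    (fun v => by simp [sumScalar_snd, mul_smul])
  map_star' a := by
    rw [ContinuousLinearMap.star_eq_adjoint, ContinuousLinearMap.eq_adjoint_iff]
    intro v w
    simp [WithLp.prod_inner_apply, map_star, ContinuousLinearMap.star_eq_adjoint,
      ContinuousLinearMap.adjoint_inner_left, inner_smul_left, inner_smul_right,
      sumScalar_fst, sumScalar_snd]

theorem sumRep_apply (ρ : A →⋆ₙₐ[ℂ] (X →L[ℂ] X)) (χ : A →⋆ₙₐ[ℂ] ℂ) (a : A)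
    (v : WithLp 2 (X × H)) :
    sumRep H ρ χ a v = WithLp.toLp 2 (ρ a v.fst, χ a • v.snd) := rfl

end SumRep

/-- Evaluation at a point as a character. -/
def evalChar {X : Type*} [TopologicalSpace X] (x : X) : (X →ᵇ ℂ) →⋆ₙₐ[ℂ] ℂ where
  toFun a := a x
  map_smul' _ _ := rfl
  map_zero' := rfl
  map_add' _ _ := rfl
  map_mul' _ _ := rfl
  map_star' _ := rfl

/-- A positive family of functionals with `φ i j (1 - E(pᵢ) E(pⱼ)*) = ⟨yᵢ, yⱼ⟩ - ⟨wᵢ, wⱼ⟩` gives a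
unital colligation whose transfer function sends `yᵢ` to `wᵢ`. -/
theorem exists_colligation {Ω : Type u} {Ψ : Set (Ω → ℂ)} (hΨ : IsTestFunctions Ψ)
    (hne : Ψ.Nonempty)
    {U : Type v} [NormedAddCommGroup U] [InnerProductSpace ℂ U] [CompleteSpace U]
    {Y : Type w} [NormedAddCommGroup Y] [InnerProductSpace ℂ Y] [CompleteSpace Y]
    {I : Type (max u w)} (p : I → Ω) (y : I → Y) (y' : I → U)
    (φ : I → I → Cb Ψ →ₗ[ℂ] ℂ) (hφ : IsPositiveFamily φ)
    (h : ∀ i j, φ i j (defect hΨ (p i) (p j)) = inner ℂ (y i) (y j) - inner ℂ (y' i) (y' j)) :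
    ∃ (X : Type (max u v w)) (_ : NormedAddCommGroup X) (_ : InnerProductSpace ℂ X)
      (_ : CompleteSpace X) (c : UnitaryColligation Ψ X Y U), c.ρ 1 = 1 ∧
      ∀ i, c.transfer (c.ρ (evalE hΨ (p i))).adjoint (y i) = y' i := by
  obtain ⟨ψ, hψ⟩ := hne
  let X₀ := UniformSpace.Completion (PreGNS hφ)
  let T : I → X₀ →L[ℂ] X₀ := fun i => PreGNS.rep hφ (star (evalE hΨ (p i)))
  let x : I → X₀ := PreGNS.vec hφ
  have hT : ∀ i j, inner ℂ (T i (x i)) (T j (x j)) =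
      inner ℂ (x i) (x j) - (inner ℂ (y i) (y j) - inner ℂ (y' i) (y' j)) := by
    intro i j
    have h1 : inner ℂ (x i) (x j) = φ i j 1 := by
      rw [← PreGNS.inner_vec_rep_vec hφ, PreGNS.rep_one]
      rfl
    have h2 : inner ℂ (T i (x i)) (T j (x j)) =
        φ i j (evalE hΨ (p i) * star (evalE hΨ (p j))) := by
      rw [← PreGNS.inner_vec_rep_vec hφ, map_mul]
      simp only [T, map_star, ContinuousLinearMap.star_eq_adjoint]
      rw [ContinuousLinearMap.adjoint_inner_left]
      rfl
    rw [← h, defect, map_sub, h1, h2]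
    ring
  -- The lurking isometry: `hT` is exactly equality of the two Gram matrices.
  obtain ⟨H, _, _, _, W, hW⟩ := exists_unitary_dilation (fun i => (T i (x i), y i))
    (fun i => (x i, y' i)) (fun i j => by rw [hT]; ring)
  -- On the added space `H` the algebra acts by the scalars a(ψ), which keeps the representation
  -- unital.
  let c : UnitaryColligation Ψ (WithLp 2 (X₀ × H)) Y U :=
    ⟨W, sumRep H (PreGNS.rep hφ) (evalChar ⟨ψ, hψ⟩)⟩
  refine ⟨WithLp 2 (X₀ × H), inferInstance, inferInstance, inferInstance, c, ?_, fun i => ?_⟩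
  · refine ContinuousLinearMap.ext fun v => ?_
    change sumRep H (PreGNS.rep hφ) (evalChar ⟨ψ, hψ⟩) 1 v = v
    rw [sumRep_apply, PreGNS.rep_one]
    have : evalChar (⟨ψ, hψ⟩ : Ψ) (1 : Cb Ψ) = 1 := rfl
    rw [this, one_smul]
    rfl
  · refine c.transfer_eq_of_op_eq (c.norm_adjoint_ρ_evalE_lt hΨ (p i))
      (h := WithLp.toLp 2 (x i, 0)) ?_
    rw [UnitaryColligation.op_apply, ← ContinuousLinearMap.star_eq_adjoint, ← map_star]
    change (W (WithLp.toLp 2 (sumRep H (PreGNS.rep hφ) (evalChar ⟨ψ, hψ⟩) _ _, _))).ofLp = _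
    rw [sumRep_apply]
    have := congrArg WithLp.ofLp (hW i)
    simpa using this

/-! ### Admissible kernels -/

theorem inner_self_sub_nonneg_iff {H : Type*} [NormedAddCommGroup H] [InnerProductSpace ℂ H]
    (f g : H) : 0 ≤ inner ℂ f f - inner ℂ g g ↔ ‖g‖ ≤ ‖f‖ := by
  have h : inner ℂ f f - inner ℂ g g = ((‖f‖ ^ 2 - ‖g‖ ^ 2 : ℝ) : ℂ) := by
    rw [inner_self_eq_norm_sq_to_K, inner_self_eq_norm_sq_to_K]
    simp
  rw [h, Complex.zero_le_real, sub_nonneg, sq_le_sq₀ (norm_nonneg _) (norm_nonneg _)]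

theorem inner_self_complex_nonneg {H : Type*} [NormedAddCommGroup H] [InnerProductSpace ℂ H]
    (f : H) : 0 ≤ inner ℂ f f := by
  have := (inner_self_sub_nonneg_iff f 0).2 (norm_zero.trans_le (norm_nonneg f))
  rwa [inner_zero_left, sub_zero] at this

section Admissible

variable {Ω : Type u} {Ψ : Set (Ω → ℂ)} {E : Type*} [NormedAddCommGroup E]
    [InnerProductSpace ℂ E] {K : Ω → Ω → (E →L[ℂ] E)}

theorem isPositiveKernel_iff :
    IsPositiveKernel K ↔ SumNonneg fun s t : Ω × E => inner ℂ s.2 (K s.1 t.1 t.2) :=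
  ⟨fun h n t => h n (fun i => (t i).1) (fun i => (t i).2), fun h n z e => h n fun i => (z i, e i)⟩

open Filter Topology in
/-- A kernel `K` with `K (1 - ψ ψ*)` positive, where `|ψ| < 1`, is positive. -/
theorem isPositiveKernel_of_sumNonneg {ψ : Ω → ℂ} (hψ : ∀ x, ‖ψ x‖ < 1)
    (h : SumNonneg fun s t : Ω × E =>
      inner ℂ s.2 (K s.1 t.1 t.2) * (1 - ψ s.1 * starRingEnd ℂ (ψ t.1))) :
    IsPositiveKernel K := by
  rw [isPositiveKernel_iff]
  intro n t
  -- Q m - Q (m + 1) is the hypothesis at vectors scaled by conjugate powers of ψ. So Q decreases to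
  -- its limit 0, and Q 0 ≥ 0 is the claim.
  let Q : ℕ → ℂ := fun m => ∑ i, ∑ j, inner ℂ (t i).2 (K (t i).1 (t j).1 (t j).2) *
    (ψ (t i).1 ^ m * starRingEnd ℂ (ψ (t j).1) ^ m)
  have hanti : Antitone Q := by
    refine antitone_nat_of_succ_le fun m => ?_
    have := h n fun i => ((t i).1, starRingEnd ℂ (ψ (t i).1) ^ m • (t i).2)
    rw [← sub_nonneg]
    refine this.trans_eq ?_
    simp only [Q, ← Finset.sum_sub_distrib, map_smul, inner_smul_left, inner_smul_right, map_pow,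
      Complex.conj_conj]
    refine Finset.sum_congr rfl fun i _ => Finset.sum_congr rfl fun j _ => by ring
  have hlim : Tendsto Q atTop (𝓝 0) := by
    have h0 : (0 : ℂ) = ∑ i, ∑ j, inner ℂ (t i).2 (K (t i).1 (t j).1 (t j).2) * (0 * 0) := by
      simp
    rw [h0]
    refine tendsto_finsetSum _ fun i _ => tendsto_finsetSum _ fun j _ => Tendsto.const_mul _
      (Tendsto.mul ?_ ?_)
    · exact tendsto_pow_atTop_nhds_zero_of_norm_lt_one (hψ _)
    · exact tendsto_pow_atTop_nhds_zero_of_norm_lt_one (by simpa using hψ _)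
  have := hanti.le_of_tendsto hlim 0
  simpa [Q] using this

variable [CompleteSpace E]

theorem inner_kerFun_kerFun [Fact (Matrix.of K).PosSemidef] (x y : Ω) (v w : E) :
    inner ℂ (RKHS.kerFun (HilbertOfKernel K) x v) (RKHS.kerFun (HilbertOfKernel K) y w) =
      inner ℂ v (K x y w) := by
  rw [RKHS.kerFun_inner, RKHS.kerFun_apply, RKHS.OfKernel.kernel_ofKernel]
  rfl

/-- The sum is ‖F‖² - ‖f‖², where f is formally the adjoint of multiplication applied to F.
Multiplying f itself by ψ gives g with ⟨F, g⟩ = ‖f‖² and ‖g‖ ≤ ‖f‖, hence ‖f‖ ≤ ‖F‖ without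
constructing the adjoint. -/
theorem IsAdmissible.sumNonneg (hK : IsAdmissible Ψ K) {ψ : Ω → ℂ} (hψ : ψ ∈ Ψ) :
    SumNonneg fun s t : Ω × E =>
      inner ℂ s.2 (K s.1 t.1 t.2) * (1 - ψ s.1 * starRingEnd ℂ (ψ t.1)) := by
  obtain ⟨hpos, h⟩ := hK
  have : Fact (Matrix.of K).PosSemidef := ⟨hpos.posSemidef⟩
  intro n t
  let F : HilbertOfKernel K := ∑ i, RKHS.kerFun (HilbertOfKernel K) (t i).1 (t i).2
  let f : HilbertOfKernel K := ∑ i, starRingEnd ℂ (ψ (t i).1) •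
    RKHS.kerFun (HilbertOfKernel K) (t i).1 (t i).2
  obtain ⟨g, hg, hgf⟩ := h ψ hψ f
  have h1 : inner ℂ F g = inner ℂ f f := by
    conv_rhs => enter [2]; unfold f
    simp only [F, sum_inner, inner_smul_left, RKHS.kerFun_inner, hg, inner_smul_right,
      Complex.conj_conj]
  have h2 : ‖f‖ ≤ ‖F‖ := by
    have h3 : ‖f‖ ^ 2 ≤ ‖F‖ * ‖f‖ := by
      calc ‖f‖ ^ 2 = ‖inner ℂ F g‖ := by
            rw [h1, inner_self_eq_norm_sq_to_K]; simp
        _ ≤ ‖F‖ * ‖g‖ := norm_inner_le_norm _ _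
        _ ≤ ‖F‖ * ‖f‖ := by gcongr
    rcases (norm_nonneg f).eq_or_lt with h0 | h0
    · rw [← h0]; exact norm_nonneg _
    · exact le_of_mul_le_mul_right (by linarith) h0
  have h4 : ∑ i, ∑ j, inner ℂ (t i).2 (K (t i).1 (t j).1 (t j).2) *
      (1 - ψ (t i).1 * starRingEnd ℂ (ψ (t j).1)) = inner ℂ F F - inner ℂ f f := by
    simp only [F, f, sum_inner, inner_smul_left, Complex.conj_conj]
    simp only [inner_sum, inner_smul_right, inner_kerFun_kerFun, Finset.mul_sum]
    rw [← Finset.sum_sub_distrib]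
    refine Finset.sum_congr rfl fun i _ => ?_
    rw [← Finset.sum_sub_distrib]
    refine Finset.sum_congr rfl fun j _ => by ring
  rw [h4, inner_self_sub_nonneg_iff]
  exact h2

/-- The hypothesis makes k_x v ↦ conj(ψ(x)) k_x v a contraction on the span of kernel functions. The
adjoint of its extension is multiplication by ψ. -/
theorem isAdmissible_of_sumNonneg (hK : IsPositiveKernel K)
    (h : ∀ ψ ∈ Ψ, SumNonneg fun s t : Ω × E =>
      inner ℂ s.2 (K s.1 t.1 t.2) * (1 - ψ s.1 * starRingEnd ℂ (ψ t.1))) :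
    IsAdmissible Ψ K := by
  refine ⟨hK, ?_⟩
  have : Fact (Matrix.of K).PosSemidef := ⟨hK.posSemidef⟩
  intro ψ hψ
  let k : Ω × E → HilbertOfKernel K := fun s => RKHS.kerFun (HilbertOfKernel K) s.1 s.2
  let k' : Ω × E → HilbertOfKernel K := fun s => starRingEnd ℂ (ψ s.1) • k s
  have hdense : DenseRange (Finsupp.linearCombination ℂ k) := by
    have h1 := Submodule.dense_iff_topologicalClosure_eq_top.2
      (RKHS.kerFun_dense (HilbertOfKernel K))
    have h2 : {RKHS.kerFun (HilbertOfKernel K) x v | (x) (v)} = Set.range k := by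
      ext g
      exact ⟨fun ⟨x, v, hg⟩ => ⟨(x, v), hg⟩, fun ⟨s, hg⟩ => ⟨s.1, s.2, hg⟩⟩
    rw [h2, ← Finsupp.range_linearCombination] at h1
    exact h1
  have hle : ∀ x, ‖Finsupp.linearCombination ℂ k' x‖ ≤ 1 * ‖Finsupp.linearCombination ℂ k x‖ := by
    intro x
    have h1 := (h ψ hψ).finset x.support fun s => (s.1, x s • s.2)
    have h2 : inner ℂ (Finsupp.linearCombination ℂ k x) (Finsupp.linearCombination ℂ k x) -
        inner ℂ (Finsupp.linearCombination ℂ k' x) (Finsupp.linearCombination ℂ k' x) =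
        ∑ s ∈ x.support, ∑ t ∈ x.support, inner ℂ (x s • s.2) (K s.1 t.1 (x t • t.2)) *
          (1 - ψ s.1 * starRingEnd ℂ (ψ t.1)) := by
      rw [inner_linearCombination, inner_linearCombination, Finsupp.sum, Finsupp.sum,
        ← Finset.sum_sub_distrib]
      refine Finset.sum_congr rfl fun i _ => ?_
      rw [Finsupp.sum, Finsupp.sum, ← Finset.sum_sub_distrib]
      refine Finset.sum_congr rfl fun j _ => ?_
      simp only [k', k, inner_smul_left, inner_smul_right, inner_kerFun_kerFun, map_smul,
        Complex.conj_conj]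
      ring
    rw [← h2, inner_self_sub_nonneg_iff] at h1
    rwa [one_mul]
  let T : HilbertOfKernel K →L[ℂ] HilbertOfKernel K :=
    (Finsupp.linearCombination ℂ k').extendOfNorm (Finsupp.linearCombination ℂ k)
  have hT : ∀ s, T (k s) = k' s := by
    intro s
    have := LinearMap.extendOfNorm_eq hdense ⟨1, hle⟩ (Finsupp.single s 1)
    simpa using this
  have hTn : ‖T‖ ≤ 1 := LinearMap.opNorm_extendOfNorm_le hdense zero_le_one hle
  intro g
  refine ⟨T.adjoint g, fun x => ext_inner_left ℂ fun v => ?_, ?_⟩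
  · rw [← RKHS.kerFun_inner, ContinuousLinearMap.adjoint_inner_right]
    change inner ℂ (T (k (x, v))) g = _
    rw [hT]
    simp only [k', k, inner_smul_left, RKHS.kerFun_inner, inner_smul_right, Complex.conj_conj]
  · have := T.adjoint.le_of_opNorm_le ((LinearIsometryEquiv.norm_map _ T).trans_le hTn) g
    rwa [one_mul] at this

end Admissible

/-! ### Tensor products of kernels -/

/-- By density and continuity it suffices to test algebraic tensors. Expanding them into elementary
tensors gives a double sum indexed by all the terms. -/
theorem isPositiveKernel_tensorOp {Ω E F : Type*} [NormedAddCommGroup E] [InnerProductSpace ℂ E]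
    [NormedAddCommGroup F] [InnerProductSpace ℂ F] {Q : Ω → Ω → (E →L[ℂ] E)}
    {K : Ω → Ω → (F →L[ℂ] F)}
    (h : SumNonneg fun s t : Ω × E × F =>
      inner ℂ s.2.1 (Q s.1 t.1 t.2.1) * inner ℂ s.2.2 (K s.1 t.1 t.2.2)) :
    IsPositiveKernel fun x y => tensorOp (Q x y) (K x y) := by
  intro n z e
  have hd : DenseRange (fun (t : Fin n → E ⊗[ℂ] F) (i : Fin n) => (t i : HilbertTensor E F)) :=
    DenseRange.piMap fun _ => UniformSpace.Completion.denseRange_coe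
  refine hd.induction_on (p := fun e => 0 ≤ ∑ i, ∑ j,
    inner ℂ (e i) (tensorOp (Q (z i) (z j)) (K (z i) (z j)) (e j))) e ?_ fun t => ?_
  · exact isClosed_le continuous_const (by fun_prop)
  choose S hS using fun i => TensorProduct.exists_finset (t i)
  have := h.fintype (J := Σ i, S i) fun a => (z a.1, a.2.1.1, a.2.1.2)
  refine this.trans_eq ?_
  simp only [Fintype.sum_sigma, tensorOp, ContinuousLinearMap.completion_apply_coe,
    UniformSpace.Completion.inner_coe]
  refine Finset.sum_congr rfl fun i _ => ?_
  rw [Finset.sum_comm]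
  refine Finset.sum_congr rfl fun j _ => ?_
  conv_rhs => rw [hS i, hS j]
  simp only [map_sum, sum_inner, inner_sum, TensorProduct.mapL_tmul, TensorProduct.inner_tmul]
  rw [Finset.sum_comm (s := S j), ← Finset.sum_coe_sort (S i)]
  refine Finset.sum_congr rfl fun a _ => ?_
  rw [← Finset.sum_coe_sort (S j)]

/-! ### The implications -/

section Implications

variable {Ω : Type u} {Ψ : Set (Ω → ℂ)} (hΨ : IsTestFunctions Ψ)
  {U : Type v} [NormedAddCommGroup U] [InnerProductSpace ℂ U] [CompleteSpace U]
  {Y : Type w} [NormedAddCommGroup Y] [InnerProductSpace ℂ Y] [CompleteSpace Y]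

theorem inner_one_sub_comp_adjoint (A B : U →L[ℂ] Y) (y y' : Y) :
    inner ℂ y ((1 - A ∘L B.adjoint) y') =
      inner ℂ y y' - inner ℂ (A.adjoint y) (B.adjoint y') := by
  rw [sub_apply, inner_sub_right, ContinuousLinearMap.adjoint_inner_left]
  rfl

/-- A unital realization of the adjoints gives an Agler decomposition. -/
theorem hasAglerDecomposition_of_realization {Ω₀ : Set Ω} {S₀ : Ω₀ → (U →L[ℂ] Y)}
    {X : Type*} [NormedAddCommGroup X] [InnerProductSpace ℂ X] [CompleteSpace X]
    (c : UnitaryColligation Ψ X Y U) (hc : c.ρ 1 = 1)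
    (h : ∀ z : Ω₀, (S₀ z).adjoint = c.transfer (c.ρ (evalE hΨ z)).adjoint) :
    HasAglerDecomposition hΨ S₀ := by
  let T : Ω₀ → X →L[ℂ] X := fun z => (c.ρ (evalE hΨ z)).adjoint
  have hT : ∀ z, ‖T z‖ < 1 := fun z => c.norm_adjoint_ρ_evalE_lt hΨ z
  let x : Ω₀ → Y →L[ℂ] X := fun z => c.state (T z)
  -- The Stinespring form x(z)* ρ(a) x(w), with x(z) the state operator, is completely positive.
  let Γ : Ω₀ → Ω₀ → (Cb Ψ →L[ℂ] (Y →L[ℂ] Y)) := fun z w => LinearMap.mkContinuous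
    { toFun := fun a => (x z).adjoint ∘L c.ρ a ∘L x w
      map_add' := fun a b => by simp
      map_smul' := fun r a => by simp } (‖(x z).adjoint‖ * ‖x w‖) fun a => by
        calc ‖(x z).adjoint ∘L c.ρ a ∘L x w‖ ≤ ‖(x z).adjoint‖ * (‖c.ρ a‖ * ‖x w‖) :=
              (ContinuousLinearMap.opNorm_comp_le _ _).trans
                (by gcongr; exact ContinuousLinearMap.opNorm_comp_le _ _)
          _ ≤ ‖(x z).adjoint‖ * (‖a‖ * ‖x w‖) := by
              gcongr; exact NonUnitalStarAlgHom.norm_apply_le c.ρ a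
          _ = _ := by ring
  have hΓ : ∀ z w a, Γ z w a = (x z).adjoint ∘L c.ρ a ∘L x w := fun z w a => rfl
  refine ⟨Γ, fun n a b z => ?_, fun z w => ?_⟩
  · let Z : Y →L[ℂ] X := ∑ i, c.ρ (a i) ∘L x (z i) ∘L b i
    have : ∑ i, ∑ j, star (b i) * Γ (z i) (z j) (star (a i) * a j) * b j = Z.adjoint ∘L Z := by
      refine ContinuousLinearMap.ext fun v => ext_inner_left ℂ fun v' => ?_
      simp only [Z, ContinuousLinearMap.comp_apply, ContinuousLinearMap.adjoint_inner_right,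
        sum_apply, sum_inner, inner_sum, hΓ, mul_apply_eq_comp,
        ContinuousLinearMap.star_eq_adjoint, map_mul, map_star]
      exact Finset.sum_comm
    rw [this, ContinuousLinearMap.nonneg_iff_isPositive]
    exact ContinuousLinearMap.isPositive_adjoint_comp_self Z
  · refine ContinuousLinearMap.ext fun v => ext_inner_left ℂ fun v' => ?_
    rw [inner_one_sub_comp_adjoint, h, h, c.inner_state (hT z) (hT w), c.inner_adjoint_ρ hΨ, hc,
      hΓ, ContinuousLinearMap.comp_apply, ContinuousLinearMap.adjoint_inner_right]
    simp only [one_apply_eq_self, sub_sub_cancel, ContinuousLinearMap.comp_apply]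
    rfl

/-- A realization of the adjoints defines a function with bound one on all of `Ω`. -/
theorem isBound_one_of_realization (hne : Ψ.Nonempty)
    {X : Type*} [NormedAddCommGroup X] [InnerProductSpace ℂ X] [CompleteSpace X]
    (c : UnitaryColligation Ψ X Y U) {S : Ω → (U →L[ℂ] Y)}
    (h : ∀ z, (S z).adjoint = c.transfer (c.ρ (evalE hΨ z)).adjoint) :
    IsBound Ψ S 1 := by
  obtain ⟨ψ₀, hψ₀⟩ := hne
  refine ⟨zero_le_one, fun k hk => isPositiveKernel_tensorOp fun n t => ?_⟩
  let T : Ω → X →L[ℂ] X := fun z => (c.ρ (evalE hΨ z)).adjoint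
  have hT : ∀ z, ‖T z‖ < 1 := fun z => c.norm_adjoint_ρ_evalE_lt hΨ z
  let x : Fin n → X := fun i => c.state (T (t i).1) (t i).2.1
  -- The projection onto the part of the space where ρ vanishes; it contributes the second summand
  -- in `hQ`.
  let P : X →L[ℂ] X := 1 - c.ρ 1
  have hP : ∀ v v', inner ℂ v (P v') = inner ℂ (P v) (P v') := by
    intro v v'
    have h1 : P.adjoint = P := by
      simp only [P, map_sub, ← ContinuousLinearMap.star_eq_adjoint, ← map_star, star_one]
    have h2 : P * P = P := by
      simp only [P, mul_sub, sub_mul, mul_one, one_mul, ← map_mul, sub_self, sub_zero]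
    rw [← ContinuousLinearMap.adjoint_inner_right, h1, ← mul_apply_eq_comp, h2]
  have hQ : ∀ i j, inner ℂ (t i).2.1 (((((1 : ℝ) : ℂ) ^ 2) • (1 : Y →L[ℂ] Y) -
      (S (t i).1) ∘L (S (t j).1).adjoint) (t j).2.1) =
      inner ℂ (x i) (c.ρ (defect hΨ (t i).1 (t j).1) (x j)) + inner ℂ (x i) (P (x j)) := by
    intro i j
    rw [Complex.ofReal_one, one_pow, one_smul, inner_one_sub_comp_adjoint, h, h,
      c.inner_state (hT _) (hT _), c.inner_adjoint_ρ hΨ]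
    simp only [P, sub_apply, one_apply_eq_self, inner_sub_right, x]
    ring
  let κ : Fin n → Fin n → ℂ := fun i j => inner ℂ (t i).2.2 (k (t i).1 (t j).1 (t j).2.2)
  have h1 : 0 ≤ ∑ i, ∑ j, inner ℂ (x i) (c.ρ (κ i j • defect hΨ (t i).1 (t j).1) (x j)) := by
    refine sum_apply_nonneg (fun i j => (innerSL ℂ (x i)).toLinearMap ∘ₗ
      (ContinuousLinearMap.apply ℂ X (x j)).toLinearMap ∘ₗ
        (c.ρ : Cb Ψ →ₗ[ℂ] (X →L[ℂ] X))) (fun a => ?_)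
      (fun i j => κ i j • defect hΨ (t i).1 (t j).1) fun ψ v => ?_
    · have : ∑ i, ∑ j, inner ℂ (x i) (c.ρ (star (a i) * a j) (x j)) =
          inner ℂ (∑ i, c.ρ (a i) (x i)) (∑ i, c.ρ (a i) (x i)) := by
        simp only [sum_inner, map_mul, map_star, mul_apply_eq_comp,
          ContinuousLinearMap.star_eq_adjoint, ContinuousLinearMap.adjoint_inner_right]
        simp only [inner_sum]
      exact (inner_self_complex_nonneg _).trans_eq this.symm
    · have := hk.sumNonneg ψ.2 n fun i => ((t i).1, v i • (t i).2.2)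
      refine this.trans_eq ?_
      refine Finset.sum_congr rfl fun i _ => Finset.sum_congr rfl fun j _ => ?_
      simp only [κ, map_smul, inner_smul_left, inner_smul_right,
        BoundedContinuousFunction.smul_apply, defect_apply, smul_eq_mul]
      ring
  -- Schur's product theorem for two positive matrices, obtained from `sum_apply_nonneg` with
  -- constant functions evaluated at ψ₀.
  have h2 : 0 ≤ ∑ i, ∑ j, inner ℂ (x i) (P (x j)) * κ i j := by
    let χ : Cb Ψ →ₗ[ℂ] ℂ := (BoundedContinuousFunction.evalCLM ℂ (⟨ψ₀, hψ₀⟩ : Ψ)).toLinearMap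
    have := sum_apply_nonneg (fun i j => inner ℂ (x i) (P (x j)) • χ) (fun a => ?_)
      (fun i j => κ i j • (1 : Cb Ψ)) fun ψ v => ?_
    · simpa [χ, mul_comm] using this
    · have : ∑ i, ∑ j, inner ℂ (x i) (P (x j)) * χ (star (a i) * a j) =
          inner ℂ (∑ i, χ (a i) • P (x i)) (∑ i, χ (a i) • P (x i)) := by
        simp only [sum_inner, inner_smul_left]
        simp only [inner_sum, inner_smul_right, Finset.mul_sum]
        refine Finset.sum_congr rfl fun i _ => Finset.sum_congr rfl fun j _ => ?_
        rw [hP]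
        simp only [χ]
        simp
        ring
      exact (inner_self_complex_nonneg _).trans_eq this.symm
    · have := isPositiveKernel_iff.1 hk.1 n fun i => ((t i).1, v i • (t i).2.2)
      refine this.trans_eq ?_
      refine Finset.sum_congr rfl fun i _ => Finset.sum_congr rfl fun j _ => ?_
      simp [κ]
      ring
  refine (add_nonneg h1 h2).trans_eq ?_
  rw [← Finset.sum_add_distrib]
  refine Finset.sum_congr rfl fun i _ => ?_
  rw [← Finset.sum_add_distrib]
  refine Finset.sum_congr rfl fun j _ => ?_
  dsimp only
  rw [hQ, map_smul]
  simp only [smul_apply, inner_smul_right, κ]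
  ring

theorem mem_schurAglerClass_of_isBound_one {S : Ω → (U →L[ℂ] Y)} (h : IsBound Ψ S 1) :
    S ∈ schurAglerClass Ψ :=
  ⟨⟨1, h⟩, csInf_le ⟨0, fun _ hC => hC.1⟩ h⟩

/-- An Agler decomposition gives a unital realization of the adjoints. -/
theorem HasAglerDecomposition.exists_realization (hne : Ψ.Nonempty) {Ω₀ : Set Ω}
    {S₀ : Ω₀ → (U →L[ℂ] Y)} (h : HasAglerDecomposition hΨ S₀) :
    ∃ (X : Type (max u v w)) (_ : NormedAddCommGroup X) (_ : InnerProductSpace ℂ X)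
      (_ : CompleteSpace X) (c : UnitaryColligation Ψ X Y U), c.ρ 1 = 1 ∧
      ∀ z : Ω₀, (S₀ z).adjoint = c.transfer (c.ρ (evalE hΨ z)).adjoint := by
  obtain ⟨Γ, hΓ, hS⟩ := h
  let φ : Ω₀ × Y → Ω₀ × Y → Cb Ψ →ₗ[ℂ] ℂ := fun s t => (innerSL ℂ s.2).toLinearMap ∘ₗ
    (ContinuousLinearMap.apply ℂ Y t.2).toLinearMap ∘ₗ (Γ s.1 t.1).toLinearMap
  have hφ : IsPositiveFamily φ := by
    intro n t
    change 0 ≤ ∑ i, ∑ j, inner ℂ (t i).1.2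
      (Γ (t i).1.1 (t j).1.1 (star (t i).2 * (t j).2) (t j).1.2)
    rcases subsingleton_or_nontrivial Y with hY | hY
    · simp [Subsingleton.elim _ (0 : Y)]
    -- The rank-one operators v ↦ ⟨e, v⟩ yᵢ send the unit vector e to yᵢ. Testing operator
    -- positivity at e therefore gives the scalar inequality.
    obtain ⟨e, he⟩ := exists_norm_eq Y (c := 1) zero_le_one
    have h1 := hΓ n (fun i => (t i).2) (fun i => InnerProductSpace.rankOne ℂ (t i).1.2 e)
      fun i => (t i).1.1
    rw [ContinuousLinearMap.nonneg_iff_isPositive] at h1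
    refine (h1.inner_nonneg_right e).trans_eq ?_
    simp only [sum_apply, inner_sum, mul_apply_eq_comp, ContinuousLinearMap.star_eq_adjoint,
      ContinuousLinearMap.adjoint_inner_right, InnerProductSpace.rankOne_apply,
      inner_self_eq_norm_sq_to_K, he]
    simp
  obtain ⟨X, _, _, _, c, hc, hcS⟩ := exists_colligation hΨ hne (fun s : Ω₀ × Y => (s.1 : Ω))
    (fun s => s.2) (fun s => (S₀ s.1).adjoint s.2) φ hφ fun s t => by
      rw [← inner_one_sub_comp_adjoint, hS]
      rfl
  exact ⟨X, _, _, _, c, hc, fun z => ContinuousLinearMap.ext fun y => (hcS (z, y)).symm⟩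

end Implications

/-! ### From the Schur–Agler class to a realization -/

section FiniteKernel

variable {Ω : Type u} {Ψ : Set (Ω → ℂ)} {Y : Type w} [NormedAddCommGroup Y]
  [InnerProductSpace ℂ Y] {ι : Type*} (b : ι → Y)

/-- The finite rank kernel with matrix entries `c` with respect to `b`. -/
def finiteKernel (F : Finset ι) (c : Ω × ι → Ω × ι → ℂ) (z w : Ω) : Y →L[ℂ] Y :=
  ∑ i ∈ F, ∑ j ∈ F, c (z, i) (w, j) • InnerProductSpace.rankOne ℂ (b i) (b j)

theorem inner_finiteKernel (F : Finset ι) (c : Ω × ι → Ω × ι → ℂ) (z w : Ω) (y y' : Y) :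
    inner ℂ y (finiteKernel b F c z w y') =
      ∑ i ∈ F, ∑ j ∈ F, inner ℂ y (b i) * inner ℂ (b j) y' * c (z, i) (w, j) := by
  simp only [finiteKernel, sum_apply, inner_sum, smul_apply, InnerProductSpace.rankOne_apply,
    inner_smul_right]
  refine Finset.sum_congr rfl fun i _ => Finset.sum_congr rfl fun j _ => by ring

theorem inner_finiteKernel_basis {b : ι → Y} (hb : Orthonormal ℂ b) {F : Finset ι}
    (c : Ω × ι → Ω × ι → ℂ) (z w : Ω) {i j : ι} (hi : i ∈ F) (hj : j ∈ F) :
    inner ℂ (b i) (finiteKernel b F c z w (b j)) = c (z, i) (w, j) := by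
  classical
  rw [inner_finiteKernel]
  simp [orthonormal_iff_ite.1 hb, hi, hj]

/-- Vectors enter only through their coefficients against `b`, so `hc` is the admissibility
inequality. Positivity of the kernel itself follows from that inequality for a single ψ. -/
theorem isAdmissible_finiteKernel [CompleteSpace Y] (hΨ : IsTestFunctions Ψ) (hne : Ψ.Nonempty)
    (F : Finset ι) (c : Ω × ι → Ω × ι → ℂ)
    (hc : ∀ ψ ∈ Ψ, SumNonneg fun a b : (Ω × ι) × ℂ => starRingEnd ℂ a.2 * b.2 * c a.1 b.1 *
        (1 - ψ a.1.1 * starRingEnd ℂ (ψ b.1.1))) :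
    IsAdmissible Ψ (finiteKernel b F c) := by
  have h : ∀ ψ ∈ Ψ, SumNonneg fun s t : Ω × Y =>
      inner ℂ s.2 (finiteKernel b F c s.1 t.1 t.2) * (1 - ψ s.1 * starRingEnd ℂ (ψ t.1)) := by
    intro ψ hψ n t
    have h1 := (hc ψ hψ).fintype (J := Fin n × F) fun k =>
      (((t k.1).1, k.2.1), inner ℂ (b k.2) (t k.1).2)
    refine h1.trans_eq ?_
    simp only [Fintype.sum_prod_type, inner_finiteKernel]
    refine Finset.sum_congr rfl fun k _ => ?_
    rw [Finset.sum_comm]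
    refine Finset.sum_congr rfl fun l _ => ?_
    rw [Finset.sum_mul, ← Finset.sum_coe_sort F]
    refine Finset.sum_congr rfl fun i _ => ?_
    rw [Finset.sum_mul, ← Finset.sum_coe_sort F]
    refine Finset.sum_congr rfl fun j _ => ?_
    rw [inner_conj_symm]
  obtain ⟨ψ, hψ⟩ := hne
  refine isAdmissible_of_sumNonneg (isPositiveKernel_of_sumNonneg (ψ := ψ) (fun x => ?_)
    (h ψ hψ)) h
  obtain ⟨r, hr, hx⟩ := hΨ.sup_lt_one x
  exact (hx ψ hψ).trans_lt hr

end FiniteKernel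

/-- Testing at ∑ᵢ bᵢ ⊗ bᵢ turns the tensor product into the entrywise pairing of the two kernels. -/
theorem IsPositiveKernel.sum_tensor_nonneg {Ω : Type*} {E : Type*} [NormedAddCommGroup E]
    [InnerProductSpace ℂ E] {Q K : Ω → Ω → (E →L[ℂ] E)}
    (h : IsPositiveKernel fun x y => tensorOp (Q x y) (K x y)) {ι : Type*} (b : ι → E)
    (G : Finset Ω) (F : Finset ι) :
    0 ≤ ∑ p ∈ G ×ˢ F, ∑ q ∈ G ×ˢ F, inner ℂ (b p.2) (K p.1 q.1 (b q.2)) *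
      inner ℂ (b p.2) (Q p.1 q.1 (b q.2)) := by
  have h1 := (isPositiveKernel_iff.1 h).finset G fun z =>
    (z, ((∑ i ∈ F, b i ⊗ₜ[ℂ] b i : E ⊗[ℂ] E) : HilbertTensor E E))
  refine h1.trans_eq ?_
  simp only [tensorOp, ContinuousLinearMap.completion_apply_coe,
    UniformSpace.Completion.inner_coe, Finset.sum_product]
  refine Finset.sum_congr rfl fun z _ => ?_
  rw [Finset.sum_comm (s := F)]
  refine Finset.sum_congr rfl fun w _ => ?_
  simp only [map_sum, sum_inner, TensorProduct.mapL_tmul]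
  simp only [inner_sum, TensorProduct.inner_tmul]
  refine Finset.sum_congr rfl fun i _ => Finset.sum_congr rfl fun j _ => mul_comm _ _

section Realization

variable {Ω : Type u} {Ψ : Set (Ω → ℂ)}
  {U : Type v} [NormedAddCommGroup U] [InnerProductSpace ℂ U] [CompleteSpace U]
  {Y : Type w} [NormedAddCommGroup Y] [InnerProductSpace ℂ Y] [CompleteSpace Y]

open Filter Topology in
/-- A quantity controlled by all bounds of `S` is controlled by the bound one. -/
theorem le_of_mem_schurAglerClass {S : Ω → (U →L[ℂ] Y)} (hS : S ∈ schurAglerClass Ψ) {σ τ : ℝ}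
    (hτ : 0 ≤ τ) (h : ∀ C, IsBound Ψ S C → σ ≤ C ^ 2 * τ) : σ ≤ τ := by
  have h1 : ∀ δ : ℝ, 1 < δ → σ ≤ δ ^ 2 * τ := by
    intro δ hδ
    -- Attainment of the infimum is not needed: any δ > 1 dominates some bound, and δ then tends to
    -- 1.
    obtain ⟨C, hC, hCδ⟩ := exists_lt_of_csInf_lt hS.1 (lt_of_le_of_lt hS.2 hδ)
    refine (h C hC).trans (mul_le_mul_of_nonneg_right ?_ hτ)
    exact pow_le_pow_left₀ hC.1 hCδ.le 2
  have h2 : Tendsto (fun δ : ℝ => δ ^ 2 * τ) (𝓝[>] 1) (𝓝 (1 ^ 2 * τ)) :=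
    ((by fun_prop : Continuous fun δ : ℝ => δ ^ 2 * τ).tendsto 1).mono_left nhdsWithin_le_nhds
  have h3 := ge_of_tendsto h2 (eventually_nhdsWithin_of_forall h1)
  simpa using h3

/-- Indexing by points and basis vectors lets orthonormality recover the separating coefficients as
entries of a `B(Y)`-valued kernel. -/
theorem exists_realization_of_mem_schurAglerClass (hΨ : IsTestFunctions Ψ) (hne : Ψ.Nonempty)
    {S : Ω → (U →L[ℂ] Y)} (hS : S ∈ schurAglerClass Ψ) :
    ∃ (X : Type (max u v w)) (_ : NormedAddCommGroup X) (_ : InnerProductSpace ℂ X)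
      (_ : CompleteSpace X) (c : UnitaryColligation Ψ X Y U), c.ρ 1 = 1 ∧
      ∀ z, (S z).adjoint = c.transfer (c.ρ (evalE hΨ z)).adjoint := by
  classical
  obtain ⟨ι, b, -⟩ := exists_hilbertBasis ℂ Y
  let T : (Ω × ι) × (Ω × ι) → ℂ := fun pq => inner ℂ (b pq.1.2) (b pq.2.2) -
    inner ℂ ((S pq.1.1).adjoint (b pq.1.2)) ((S pq.2.1).adjoint (b pq.2.2))
  have hT : T ∈ aglerCone hΨ (Prod.fst : Ω × ι → Ω) := by
    refine mem_aglerCone_of_forall hΨ _ T (fun p q => by simp [T, inner_conj_symm])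
      fun s c hs hc => ?_
    let G : Finset Ω := s.image Prod.fst
    let F : Finset ι := s.image Prod.snd
    have hsub : s ⊆ G ×ˢ F := fun p hp =>
      Finset.mem_product.2 ⟨Finset.mem_image_of_mem _ hp, Finset.mem_image_of_mem _ hp⟩
    have hadm := isAdmissible_finiteKernel b hΨ hne F c hc
    have hsum : ∀ t : Ω × ι → Ω × ι → ℂ, ∑ p ∈ s, ∑ q ∈ s, c p q * t p q =
        ∑ p ∈ G ×ˢ F, ∑ q ∈ G ×ˢ F, c p q * t p q := by
      intro t
      refine (Finset.sum_congr rfl fun p _ => ?_).trans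
        (Finset.sum_subset hsub fun p _ hp => Finset.sum_eq_zero fun q _ => ?_)
      · exact Finset.sum_subset hsub fun q _ hq => by rw [hs p q (.inr hq), zero_mul]
      · rw [hs p q (.inl hp), zero_mul]
    have hk : ∀ p ∈ G ×ˢ F, ∀ q ∈ G ×ˢ F,
        inner ℂ (b p.2) (finiteKernel b F c p.1 q.1 (b q.2)) = c p q := fun p hp q hq =>
      inner_finiteKernel_basis b.orthonormal c _ _ (Finset.mem_product.1 hp).2
        (Finset.mem_product.1 hq).2
    let τ : ℂ := ∑ p ∈ s, ∑ q ∈ s, c p q * inner ℂ (b p.2) (b q.2)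
    let σ : ℂ := ∑ p ∈ s, ∑ q ∈ s, c p q *
      inner ℂ ((S p.1).adjoint (b p.2)) ((S q.1).adjoint (b q.2))
    -- Orthonormality leaves only i = j, so τ is a sum of values of the positive kernel form. This
    -- sign is needed to compare C² τ for different bounds C.
    have hτ : 0 ≤ τ.re := by
      have : τ = ∑ i ∈ F, ∑ z ∈ G, ∑ w ∈ G, inner ℂ (b i) (finiteKernel b F c z w (b i)) := by
        simp only [τ, hsum, Finset.sum_product, orthonormal_iff_ite.1 b.orthonormal]
        rw [Finset.sum_comm]
        refine Finset.sum_congr rfl fun i hi => Finset.sum_congr rfl fun z _ =>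
          Finset.sum_congr rfl fun w _ => ?_
        rw [inner_finiteKernel_basis b.orthonormal c _ _ hi hi]
        simp [hi]
      rw [this]
      exact (Complex.le_def.1 (Finset.sum_nonneg fun i _ =>
        (isPositiveKernel_iff.1 hadm.1).finset G fun z => (z, b i))).1
    have hστ : ∑ p ∈ s, ∑ q ∈ s, c p q * T (p, q) = τ - σ := by
      simp only [T, τ, σ, mul_sub, Finset.sum_sub_distrib]
    rw [hστ, Complex.sub_re, sub_nonneg]
    refine le_of_mem_schurAglerClass hS hτ fun C hC => ?_
    have h1 := (Complex.le_def.1 ((hC.2 _ hadm).sum_tensor_nonneg b G F)).1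
    have h2 : ∑ p ∈ G ×ˢ F, ∑ q ∈ G ×ˢ F,
        inner ℂ (b p.2) (finiteKernel b F c p.1 q.1 (b q.2)) *
          inner ℂ (b p.2) ((((C : ℂ) ^ 2) • (1 : Y →L[ℂ] Y) - (S p.1) ∘L (S q.1).adjoint) (b q.2)) =
        ((C ^ 2 : ℝ) : ℂ) * τ - σ := by
      simp only [τ, σ, hsum, Finset.mul_sum]
      rw [← Finset.sum_sub_distrib]
      refine Finset.sum_congr rfl fun p hp => ?_
      rw [← Finset.sum_sub_distrib]
      refine Finset.sum_congr rfl fun q hq => ?_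
      rw [hk p hp q hq, sub_apply, inner_sub_right, ContinuousLinearMap.adjoint_inner_left,
        smul_apply, inner_smul_right, one_apply_eq_self, ContinuousLinearMap.comp_apply]
      push_cast
      ring
    rw [h2, Complex.sub_re, Complex.re_ofReal_mul] at h1
    simpa using h1
  obtain ⟨φ, hφ, hφT⟩ := hT
  obtain ⟨X, _, _, _, c, hc, hcS⟩ := exists_colligation hΨ hne (Prod.fst : Ω × ι → Ω)
    (fun p => b p.2) (fun p => (S p.1).adjoint (b p.2)) φ hφ fun p q => (hφT p q).symm
  refine ⟨X, _, _, _, c, hc, fun z => ?_⟩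
  refine ContinuousLinearMap.ext_on
    (Submodule.dense_iff_topologicalClosure_eq_top.2 b.dense_span) ?_
  rintro _ ⟨i, rfl⟩
  exact (hcS (z, i)).symm

end Realization

end

end SchurAgler

theorem theorem2p1 {Ω : Type u} {Ψ : Set (Ω → ℂ)} (hΨ : IsTestFunctions Ψ) (hne : Ψ.Nonempty)
    {U : Type v} [NormedAddCommGroup U] [InnerProductSpace ℂ U] [CompleteSpace U]
    {Y : Type w} [NormedAddCommGroup Y] [InnerProductSpace ℂ Y] [CompleteSpace Y]
    (Ω₀ : Set Ω) (S₀ : Ω₀ → (U →L[ℂ] Y)) :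
    List.TFAE [
      -- (1) `S₀` extends to a member of the Schur-Agler class
      ∃ S ∈ schurAglerClass (U := U) (Y := Y) Ψ, ∀ z : Ω₀, S z = S₀ z,
      -- (2) Agler decomposition
      HasAglerDecomposition hΨ S₀,
      -- (3) realization of `S₀` as a transfer function
      ∃ (X : Type (max u v w)) (_ : NormedAddCommGroup X) (_ : InnerProductSpace ℂ X)
        (_ : CompleteSpace X) (c : UnitaryColligation Ψ X U Y),
        ∀ z : Ω₀, S₀ z = c.transfer (c.ρ (evalE hΨ z)),
      -- (4) realization of the adjoints
      ∃ (X : Type (max u v w)) (_ : NormedAddCommGroup X) (_ : InnerProductSpace ℂ X)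
        (_ : CompleteSpace X) (c : UnitaryColligation Ψ X Y U),
        ∀ z : Ω₀, (S₀ z).adjoint = c.transfer (c.ρ (evalE hΨ z)).adjoint,
      -- (3) with a unital representation
      ∃ (X : Type (max u v w)) (_ : NormedAddCommGroup X) (_ : InnerProductSpace ℂ X)
        (_ : CompleteSpace X) (c : UnitaryColligation Ψ X U Y), c.ρ 1 = 1 ∧
        ∀ z : Ω₀, S₀ z = c.transfer (c.ρ (evalE hΨ z)),
      -- (4) with a unital representation
      ∃ (X : Type (max u v w)) (_ : NormedAddCommGroup X) (_ : InnerProductSpace ℂ X)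
        (_ : CompleteSpace X) (c : UnitaryColligation Ψ X Y U), c.ρ 1 = 1 ∧
        ∀ z : Ω₀, (S₀ z).adjoint = c.transfer (c.ρ (evalE hΨ z)).adjoint] := by
  tfae_have 1 → 6 := by
    rintro ⟨S, hS, hS₀⟩
    obtain ⟨X, i₁, i₂, i₃, c, hc, h⟩ := exists_realization_of_mem_schurAglerClass hΨ hne hS
    exact ⟨X, i₁, i₂, i₃, c, hc, fun z => by rw [← hS₀, h]⟩
  tfae_have 6 → 2 := by
    rintro ⟨X, i₁, i₂, i₃, c, hc, h⟩
    exact hasAglerDecomposition_of_realization hΨ c hc h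
  tfae_have 2 → 6 := fun h => h.exists_realization hΨ hne
  tfae_have 6 → 4 := fun ⟨X, i₁, i₂, i₃, c, _, h⟩ => ⟨X, i₁, i₂, i₃, c, h⟩
  tfae_have 4 → 1 := by
    -- The transfer formula is used at every point of Ω to define the extension.
    rintro ⟨X, i₁, i₂, i₃, c, h⟩
    refine ⟨fun z => (c.transfer (c.ρ (evalE hΨ z)).adjoint).adjoint,
      mem_schurAglerClass_of_isBound_one (isBound_one_of_realization hΨ hne c fun z => ?_),
      fun z => ?_⟩
    · rw [ContinuousLinearMap.adjoint_adjoint]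
    · change (c.transfer (c.ρ (evalE hΨ z)).adjoint).adjoint = S₀ z
      rw [← h, ContinuousLinearMap.adjoint_adjoint]
  tfae_have 6 → 5 := by
    rintro ⟨X, i₁, i₂, i₃, c, hc, h⟩
    refine ⟨X, i₁, i₂, i₃, c.symm, hc, fun z => ?_⟩
    rw [← (S₀ z).adjoint_adjoint, h, c.adjoint_transfer (c.norm_adjoint_ρ_evalE_lt hΨ z),
      ContinuousLinearMap.adjoint_adjoint]
    rfl
  tfae_have 5 → 3 := fun ⟨X, i₁, i₂, i₃, c, _, h⟩ => ⟨X, i₁, i₂, i₃, c, h⟩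
  -- Taking adjoints replaces V by V* = V⁻¹, hence `c.symm`.
  tfae_have 3 → 4 := by
    rintro ⟨X, i₁, i₂, i₃, c, h⟩
    refine ⟨X, i₁, i₂, i₃, c.symm, fun z => ?_⟩
    rw [h, c.adjoint_transfer (c.norm_ρ_evalE_lt hΨ z)]
    rfl
  tfae_finish
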